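/- Let $\mathbb K$ be a field of characteristic $0$, let $r\ge 1$, and let $V$ be a $\mathbb K$-vector space with basis $(e_i)$ indexed by $i\in\{-r,\dots,-1,1,\dots,r\}$. Let $\mathbf q=(q_{ij},q_i)$ be a family of non-zero elements of $\mathbb K$ such that $$q_{ij}=q_{ji}^{-1},\qquad q_{ii}=1,\qquad q_{-i}=q_i^{-1},\qquad q_{-i,j}=q_{ij}^{-1}q_j^2$$ for all $i,j$. Put $\varepsilon_i=1$ for $i>0$, $\varepsilon_i=-1$ for $i<0$, define $P_{\mathbf q},Q_{\mathbf q}\in\operatorname{End}(V\otimes V)$ by $$P_{\mathbf q}(e_i\otimes e_j)=q_{ij}\,e_j\otimes e_i,\qquad Q_{\mathbf q}(e_j\otimes e_m)=\delta_{j,-m}\sum_i\varepsilon_i\varepsilon_jq_iq_j^{-1}\,e_i\otimes e_{-i},$$ and put $C_{\mathbf q}=\frac{1-P_{\mathbf q}}2-\frac{Q_{\mathbf q}}{2r}$. For an idempotent $A\in\operatorname{End}(V\otimes V)$ with entries $A(e_l\otimes e_m)=\sum_{i,j}A^{ij}_{lm}e_i\otimes e_j$, let $\Xi_A(\mathbb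 K)$ be the graded algebra with generators $\psi_i$ and relations $\sum_{i,j}(1-A)^{ij}_{lm}\psi_i\psi_j=0$ for all $l,m$, and let $\Xi^*_A(\mathbb K)$ be the graded algebra with generators $\psi^i$ and relations $\sum_{l,m}(1-A)^{ij}_{lm}\psi^l\psi^m=0$ for all $i,j$. An operator $T\in\operatorname{End}(V^{\otimes k})$ is the $k$-th pairing $A$-operator of $A$ if $(1-A^{(a,a+1)})T=0=T(1-A^{(a,a+1)})$ for $1\le a<k$, where $A^{(a,a+1)}$ is $A$ acting on the tensor factors $a$ and $a+1$, and $$\sum_IT^I_J\,\psi_{i_1}\cdots\psi_{i_k}=\psi_{j_1}\cdots\psi_{j_k},\qquad \sum_JT^I_J\,\psi^{j_1}\cdots\psi^{j_k}=\psi^{i_1}\cdots\psi^{i_k}$$ for all multi-indices $J=(j_1,\dots,j_k)$, respectively $I=(i_1,\dots,i_k)$. For an idempotent $\widetilde A\in\operatorname{End}(\widetilde V\otimes\widetilde V)$, $\dim\widetilde V<\infty$, an $(A,\widetilde A)$-Manin matrix over a $\mathbb K$-algebra $\mathfrak R$ is $M\in\mathfrak R\otimes\operatorname{Hom}(\widetilde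 V,V)$ with $AM^{(1)}M^{(2)}(1-\widetilde A)=0$; its $k$-th $A$-minors are the entries of $TM^{(1)}\cdots M^{(k)}$, where $T$ is the $k$-th pairing $A$-operator of $A$. Finally, for $2\le k\le r+1$ put $C_{\mathbf q,(k)}=\rho_{\mathbf q}(s_{(k)})$, where $\rho_{\mathbf q}$ is the representation of the Brauer algebra with parameter $\omega=-2r$ (generators $\sigma_a,\epsilon_a$, $1\le a<k$) on $V^{\otimes k}$ given by $\sigma_a\mapsto-P_{\mathbf q}^{(a,a+1)}$, $\epsilon_a\mapsto-Q_{\mathbf q}^{(a,a+1)}$, and $$s_{(k)}=\frac1{k!}\prod_{b=2}^k\frac{(y_b+1)(y_b+\omega+b-3)}{2b+\omega-4},\qquad y_b=\sum_{a=1}^{b-1}(\sigma_{ab}-\epsilon_{ab}),$$ with $\sigma_{ab}=\tau\sigma_{b-1}\tau^{-1}$, $\epsilon_{ab}=\tau\epsilon_{b-1}\tau^{-1}$, $\tau=\sigma_a\sigma_{a+1}\cdots\sigma_{b-2}$. Then: 1. $\displaystyle\dim\Xi_{C_{\mathbf q}}(\mathbb K)_k=\frac{2r-2k+2}{k}\binom{2r+1}{k-1}$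 for $k=1,2,\dots,r+1$. 2. $\Xi_{C_{\mathbf q}}(\mathbb K)_k=0$ for all $k\ge r+1$. 3. For $k=2,\dots,r+1$ the trace of $C_{\mathbf q,(k)}$ does not depend on $\mathbf q$. 4. For all $k\ge r+1$ the $k$-th pairing $A$-operator of $C_{\mathbf q}$ exists and is $0$, and all $k$-th $A$-minors of every $(C_{\mathbf q},\widetilde A)$-Manin matrix, for every idempotent $\widetilde A$, vanish. -/

import Mathlib

namespace ManinC

/-! ### Quadratic algebras attached to an operator on the tensor square

Operators on `V ⊗ V` and on the `k`-fold tensor power of `V` are given by their entries in the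
bases `e_i ⊗ e_j` and `e_{i_1} ⊗ ⋯ ⊗ e_{i_k}`: the upper (row) multi-index of an entry is the first
argument of the matrix and the lower (column) multi-index is the second one, so that
`T e_J = ∑ I, T I J • e_I`. -/

section Quadratic

variable {K : Type*} [Field K] {ι : Type*} [Fintype ι]

/-- For every row `c` of `R`, the relation `∑ i j, R c (i, j) • (x_i * x_j) = 0`. -/
inductive QuadRel (R : Matrix (ι × ι) (ι × ι) K) : FreeAlgebra K ι → FreeAlgebra K ι → Prop
  | row (c : ι × ι) :
      QuadRel R (∑ p : ι × ι, R c p • (FreeAlgebra.ι K p.1 * FreeAlgebra.ι K p.2)) 0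

/-- The quadratic algebra with generators `x_i` and with one relation for each row of `R`. -/
abbrev QuadAlg (R : Matrix (ι × ι) (ι × ι) K) : Type _ := RingQuot (QuadRel R)

/-- The generators of the quadratic algebra. -/
def QuadAlg.gen (R : Matrix (ι × ι) (ι × ι) K) (i : ι) : QuadAlg R :=
  RingQuot.mkAlgHom K (QuadRel R) (FreeAlgebra.ι K i)

/-- The monomial `x_{i_1} ⋯ x_{i_k}`. -/
def QuadAlg.monomial (R : Matrix (ι × ι) (ι × ι) K) {k : ℕ} (I : Fin k → ι) : QuadAlg R :=
  (List.ofFn fun a => QuadAlg.gen R (I a)).prod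

/-- The `k`-th graded component, i.e. the image of the component of degree `k` of the free algebra:
the span of the monomials of length `k` in the generators. -/
def QuadAlg.component (R : Matrix (ι × ι) (ι × ι) K) (k : ℕ) : Submodule K (QuadAlg R) :=
  Submodule.span K (Set.range fun I : Fin k → ι => QuadAlg.monomial R I)

variable [DecidableEq ι]

/-- `Ξ_A(K)`: generators `ψ_i`, relations `(Ψ ⊗ Ψ)(1 - A) = 0`, that is
`∑ i j, (1 - A)^{ij}_{lm} ψ_i ψ_j = 0` for all `l, m`. -/
abbrev Xi (A : Matrix (ι × ι) (ι × ι) K) : Type _ := QuadAlg (1 - A).transpose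

/-- `Ξ_A(K)_k`. -/
abbrev Xi.component (A : Matrix (ι × ι) (ι × ι) K) (k : ℕ) : Submodule K (Xi A) :=
  QuadAlg.component (1 - A).transpose k

/-- `ψ_{i_1} ⋯ ψ_{i_k}` in `Ξ_A(K)`. -/
abbrev Xi.psi (A : Matrix (ι × ι) (ι × ι) K) {k : ℕ} (I : Fin k → ι) : Xi A :=
  QuadAlg.monomial (1 - A).transpose I

/-- `Ξ*_A(K)`: generators `ψ^i`, relations `(1 - A)(Ψ* ⊗ Ψ*) = 0`, that is
`∑ l m, (1 - A)^{ij}_{lm} ψ^l ψ^m = 0` for all `i, j`. -/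
abbrev XiStar (A : Matrix (ι × ι) (ι × ι) K) : Type _ := QuadAlg (1 - A)

/-- `ψ^{i_1} ⋯ ψ^{i_k}` in `Ξ*_A(K)`. -/
abbrev XiStar.psi (A : Matrix (ι × ι) (ι × ι) K) {k : ℕ} (I : Fin k → ι) : XiStar A :=
  QuadAlg.monomial (1 - A) I

/-- `T^{(ab)}`: the operator `T` acting on the sites `a` and `b` of the `k`-fold tensor power. -/
def siteOp (T : Matrix (ι × ι) (ι × ι) K) {k : ℕ} (a b : Fin k) :
    Matrix (Fin k → ι) (Fin k → ι) K :=
  fun I J => if ∀ c, c ≠ a → c ≠ b → I c = J c then T (I a, I b) (J a, J b) else 0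

/-- `T^{(a,a+1)}`, where the sites are numbered `1, …, k` and `1 ≤ a ≤ k - 1` (zero for other
values of `a`, which are not used). -/
def adjOp (T : Matrix (ι × ι) (ι × ι) K) (k a : ℕ) : Matrix (Fin k → ι) (Fin k → ι) K :=
  if h : 1 ≤ a ∧ a < k then siteOp T ⟨a - 1, by omega⟩ ⟨a, h.2⟩ else 0

/-- `T` is the `k`-th pairing `A`-operator of the idempotent `A`. The first two conditions say that
`⟨ψ^I, ψ_J⟩ = T^I_J` is a well-defined pairing of `Ξ*_A(K)_k` and `Ξ_A(K)_k`; the last two,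
`(Ψ ⊗ ⋯ ⊗ Ψ) T = Ψ ⊗ ⋯ ⊗ Ψ` and `T (Ψ* ⊗ ⋯ ⊗ Ψ*) = Ψ* ⊗ ⋯ ⊗ Ψ*`, make it non-degenerate and fix
its normalisation. -/
structure IsPairingAOperator (A : Matrix (ι × ι) (ι × ι) K) (k : ℕ)
    (T : Matrix (Fin k → ι) (Fin k → ι) K) : Prop where
  left_eq : ∀ a, 1 ≤ a → a < k → (1 - adjOp A k a) * T = 0
  right_eq : ∀ a, 1 ≤ a → a < k → T * (1 - adjOp A k a) = 0
  psi_eq : ∀ J : Fin k → ι, ∑ I : Fin k → ι, T I J • Xi.psi A I = Xi.psi A J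
  psiStar_eq : ∀ I : Fin k → ι, ∑ J : Fin k → ι, T I J • XiStar.psi A J = XiStar.psi A I

end Quadratic

/-! ### Manin matrices and their `A`-minors -/

section Manin

variable {K : Type*} [Field K] {ι κ : Type*} [Fintype ι] [Fintype κ]
  {𝔯 : Type*} [Ring 𝔯] [Algebra K 𝔯]

/-- `M` is an `(A, B)`-Manin matrix over `𝔯`: `A M^{(1)} M^{(2)} (1 - B) = 0`, entry by entry. -/
def IsManinMatrix (A : Matrix (ι × ι) (ι × ι) K) (B : Matrix (κ × κ) (κ × κ) K)
    (M : Matrix ι κ 𝔯) : Prop :=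
  ∀ (c : ι × ι) (d : κ × κ),
    ∑ p : ι × ι, A c p • (M p.1 d.1 * M p.2 d.2) =
      ∑ p : ι × ι, ∑ s : κ × κ, (A c p * B s d) • (M p.1 s.1 * M p.2 s.2)

/-- The operator `T M^{(1)} ⋯ M^{(k)}`; if `T` is the `k`-th pairing `A`-operator of `A`, its entries
are the `k`-th `A`-minors of `M`. -/
def aMinor {k : ℕ} (T : Matrix (Fin k → ι) (Fin k → ι) K) (M : Matrix ι κ 𝔯) :
    Matrix (Fin k → ι) (Fin k → κ) 𝔯 :=
  fun I L => ∑ J : Fin k → ι, T I J • (List.ofFn fun a => M (J a) (L a)).prod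

end Manin

/-! ### The multi-parametric deformation of type `C` -/

/-- The index set `{-r, …, -1, 1, …, r}`: `Sum.inl i` stands for `i + 1` and `Sum.inr i` for
`-(i + 1)`, so that `Sum.swap` is the change of sign. -/
abbrev Idx (r : ℕ) : Type := Fin r ⊕ Fin r

/-- The opposite index `-i`. -/
abbrev Idx.opp {r : ℕ} (i : Idx r) : Idx r := i.swap

/-- `ε_i`, the sign of the index `i`. -/
def Idx.sgn (K : Type*) [Field K] {r : ℕ} (i : Idx r) : K := Sum.elim (fun _ => 1) (fun _ => -1) i

/-- A family of parameters `(q_ij, q_i)`. -/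
structure ParamFamily (K : Type*) [Field K] (r : ℕ) where
  qm : Idx r → Idx r → K
  qv : Idx r → K
  qm_ne_zero : ∀ i j, qm i j ≠ 0
  qv_ne_zero : ∀ i, qv i ≠ 0
  qm_symm : ∀ i j, qm i j = (qm j i)⁻¹
  qm_diag : ∀ i, qm i i = 1
  qv_opp : ∀ i, qv i.opp = (qv i)⁻¹
  qm_opp : ∀ i j, qm i.opp j = (qm i j)⁻¹ * qv j ^ 2

section TypeC

variable {K : Type*} [Field K] {r : ℕ}

/-- `(P_q)^{lm}_{ij} = q_ij δ^l_j δ^m_i`. -/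
def opP (q : ParamFamily K r) : Matrix (Idx r × Idx r) (Idx r × Idx r) K :=
  fun u d => if u.1 = d.2 ∧ u.2 = d.1 then q.qm d.1 d.2 else 0

/-- `(Q_q)^{il}_{jm} = ε_i ε_j q_i q_j⁻¹ δ^{i,-l} δ_{j,-m}`. -/
def opQ (q : ParamFamily K r) : Matrix (Idx r × Idx r) (Idx r × Idx r) K :=
  fun u d => if u.1 = u.2.opp ∧ d.1 = d.2.opp then
    u.1.sgn K * d.1.sgn K * q.qv u.1 * (q.qv d.1)⁻¹ else 0

/-- `C_q = (1 - P_q)/2 - Q_q/(2r)`. -/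
def opC (q : ParamFamily K r) : Matrix (Idx r × Idx r) (Idx r × Idx r) K :=
  (2 : K)⁻¹ • (1 - opP q) - (2 * (r : K))⁻¹ • opQ q

end TypeC

section Brauer

variable {K : Type*} [Field K] {B : Type*} [Ring B] [Algebra K B]

/-- `τ x_{b-1} τ⁻¹` with `τ = σ_a σ_{a+1} ⋯ σ_{b-2}`, for `a < b` and involutive `σ_c`. For `x = σ`
and `x = ε` this gives the elements `σ_{ab}` and `ε_{ab}` of the Brauer algebra. -/
def brauerConj (σ x : ℕ → B) (a b : ℕ) : B :=
  ((List.Ico a (b - 1)).map σ).prod * x (b - 1) * ((List.Ico a (b - 1)).reverse.map σ).prod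

/-- `y_b = ∑_{a=1}^{b-1} (σ_{ab} - ε_{ab})`. -/
def brauerY (σ ε : ℕ → B) (b : ℕ) : B :=
  ∑ a ∈ Finset.Ico 1 b, (brauerConj σ σ a b - brauerConj σ ε a b)

/-- The idempotent
`s_(k) = (1/k!) ∏_{b=2}^k (y_b + 1)(y_b + ω + b - 3) / (2b + ω - 4)` of the Brauer algebra
with parameter `ω`, evaluated at elements `σ_a, ε_a` (`1 ≤ a ≤ k - 1`) of an algebra that satisfy
the defining relations of the Brauer algebra. -/
def brauerS (ω : K) (k : ℕ) (σ ε : ℕ → B) : B :=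
  ((Nat.factorial k : K))⁻¹ •
    ((List.Ico 2 (k + 1)).map fun b : ℕ =>
      (2 * (b : K) + ω - 4)⁻¹ •
        ((brauerY σ ε b + 1) *
          (brauerY σ ε b + algebraMap K B (ω + (b : K) - 3)))).prod

end Brauer

/-- `C_{q,(k)} = ρ_q(s_(k))`, where `ρ_q` is the representation of the Brauer algebra with
parameter `-2r` given by `σ_a ↦ -P_q^{(a,a+1)}`, `ε_a ↦ -Q_q^{(a,a+1)}`. -/
def opCk {K : Type*} [Field K] {r : ℕ} (q : ParamFamily K r) (k : ℕ) :
    Matrix (Fin k → Idx r) (Fin k → Idx r) K :=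
  brauerS (-(2 * (r : K))) k (fun a => -adjOp (opP q) k a) (fun a => -adjOp (opQ q) k a)

end ManinC

/-! Write `Ω = ∑ q_l ψ_l ψ_{-l}`, summed over `l > 0`. In characteristic 0 the relations of
`Ξ_{C_q}` amount to `ψ_i ψ_j = -q_ij ψ_j ψ_i` together with the single relation `Ω = 0`
(`quadRelations_iff`). Thus `Ξ_{C_q}` is the quantum exterior algebra on `2r` generators modulo the
ideal of `Ω`. Since `ψ_j Ω = q_j⁻² Ω ψ_j`, this ideal is the image of left multiplication by `Ω`
(`ker_extToXi`).

In the basis of increasing monomials, `q_l ψ_l ψ_{-l}` adds the pair `{l, -l}` to an index set with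
a nonzero coefficient, and these operators commute. With the removal of pairs (inverse coefficients)
and the grading shifted by `r` they form an `sl₂`-triple (`isSl2Triple_pairWeight`). As in the
Lefschetz theorem, `Ω` is injective in degrees below `r`: a nonzero vector that it kills would be
primitive of negative weight. Hence `dim Ξ_k = C(2r, k) - C(2r, k-2)` for `2 ≤ k ≤ r + 1`. This is
zero at `k = r + 1`, and the vanishing passes to all higher degrees.

If `T (1 - A^{(a,a+1)}) = 0` for all `a`, the rows of `T` are functionals on `Ξ_k`; so `T = 0` once
`Ξ_k = 0` (`eq_zero_of_mul_one_sub_adjOp`). The dual algebra is `Ξ` for transposed parameters, so it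
vanishes in the same degrees, and `0` is indeed a pairing operator.

For the trace, one invertible diagonal matrix, with entries `∏_{a<b} h(i_a, i_b)`, intertwines the
undeformed `P` and `Q` with `P_q` and `Q_q` at all adjacent sites, hence also the images of `s_(k)`
(`trace_opCk`). -/

namespace ManinC

/-! ### The quantum exterior algebra and straightening of monomials -/

section QuantumExterior

variable {K : Type*} [Field K] {ι : Type*} [LinearOrder ι]

/-- The scalar that appears when `x_j` is moved to its place in the increasing monomial `x_S`. -/
def reorderCoeff (q : ι → ι → K) (j : ι) (S : Finset ι) : K := ∏ i ∈ S with i < j, -q j i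

theorem reorderCoeff_insert_of_lt (q : ι → ι → K) {i j : ι} {S : Finset ι} (hi : i ∉ S)
    (h : i < j) : reorderCoeff q j (insert i S) = -q j i * reorderCoeff q j S := by
  unfold reorderCoeff
  rw [Finset.filter_insert, if_pos h, Finset.prod_insert (by simp [hi])]

theorem reorderCoeff_insert_of_not_lt (q : ι → ι → K) {i j : ι} {S : Finset ι} (h : ¬ i < j) :
    reorderCoeff q j (insert i S) = reorderCoeff q j S := by
  unfold reorderCoeff
  rw [Finset.filter_insert, if_neg h]

theorem reorderCoeff_of_forall_lt (q : ι → ι → K) {j : ι} {S : Finset ι}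
    (h : ∀ i ∈ S, j < i) : reorderCoeff q j S = 1 := by
  unfold reorderCoeff
  rw [Finset.filter_false_of_mem (fun i hi => (h i hi).not_gt), Finset.prod_empty]

theorem reorderCoeff_ne_zero {q : ι → ι → K} (hq : ∀ i j, q i j ≠ 0) (j : ι) (S : Finset ι) :
    reorderCoeff q j S ≠ 0 :=
  Finset.prod_ne_zero_iff.mpr fun i _ => neg_ne_zero.mpr (hq j i)

/-- Left multiplication by `x_j` in the quantum exterior algebra `x_i x_j = -q_ij x_j x_i`, in the
basis of increasing monomials. -/
noncomputable def leftMul (q : ι → ι → K) (j : ι) : Module.End K (Finset ι →₀ K) :=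
  Finsupp.linearCombination K fun S =>
    if j ∈ S then 0 else Finsupp.single (insert j S) (reorderCoeff q j S)

theorem leftMul_single (q : ι → ι → K) (j : ι) (S : Finset ι) (a : K) :
    leftMul q j (Finsupp.single S a) =
      if j ∈ S then 0 else Finsupp.single (insert j S) (a * reorderCoeff q j S) := by
  simp [leftMul, Finsupp.linearCombination_single]

/-- The two orders of insertion differ only by the factor that the larger index picks up when it
passes the smaller one. Realising the relations on a space with basis the finite sets is what later
yields the independence of increasing monomials. -/
theorem leftMul_mul_leftMul {q : ι → ι → K} (hq : ∀ i j, q i j * q j i = 1) (i j : ι) :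
    leftMul q i * leftMul q j = -(q i j • (leftMul q j * leftMul q i)) := by
  refine Finsupp.lhom_ext fun S a => ?_
  simp only [Module.End.mul_apply, LinearMap.neg_apply, LinearMap.smul_apply, leftMul_single]
  by_cases hi : i ∈ S
  · rw [if_pos hi, map_zero, smul_zero, neg_zero]
    split_ifs
    · rw [map_zero]
    · rw [leftMul_single, if_pos (Finset.mem_insert_of_mem hi)]
  by_cases hj : j ∈ S
  · rw [if_pos hj, map_zero, if_neg hi, leftMul_single, if_pos (Finset.mem_insert_of_mem hj),
      smul_zero, neg_zero]
  simp only [hi, hj, if_false, leftMul_single, Finset.mem_insert, or_false]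
  rcases lt_trichotomy i j with h | rfl | h
  · rw [if_neg h.ne, if_neg h.ne', reorderCoeff_insert_of_lt q hi h,
      reorderCoeff_insert_of_not_lt q h.not_gt, Finset.insert_comm j i, Finsupp.smul_single,
      ← Finsupp.single_neg]
    congr 1
    linear_combination -a * reorderCoeff q i S * reorderCoeff q j S * hq i j
  · simp
  · rw [if_neg h.ne, if_neg h.ne', reorderCoeff_insert_of_lt q hj h,
      reorderCoeff_insert_of_not_lt q h.not_gt, Finset.insert_comm j i, Finsupp.smul_single,
      ← Finsupp.single_neg]
    congr 1
    simp only [smul_eq_mul]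
    ring

variable {B : Type*} [Ring B] [Algebra K B]

theorem notMem_of_forall_lt {a : ι} {S : Finset ι} (h : ∀ b ∈ S, a < b) : a ∉ S :=
  fun ha => lt_irrefl a (h a ha)

/-- The product of the `x_i`, `i ∈ S`, in increasing order. -/
def orderedMonomial (x : ι → B) (S : Finset ι) : B := ((S.sort (· ≤ ·)).map x).prod

theorem orderedMonomial_empty (x : ι → B) : orderedMonomial x ∅ = 1 := by
  simp [orderedMonomial]

theorem orderedMonomial_insert (x : ι → B) {a : ι} {S : Finset ι} (h : ∀ b ∈ S, a < b) :
    orderedMonomial x (insert a S) = x a * orderedMonomial x S := by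
  unfold orderedMonomial
  rw [Finset.sort_insert _ (fun b hb => (h b hb).le) (notMem_of_forall_lt h),
    List.map_cons, List.prod_cons]

theorem exists_orderedMonomial_eq (x : ι → B) (S : Finset ι) :
    ∃ I : Fin S.card → ι, orderedMonomial x S = (List.ofFn fun a => x (I a)).prod := by
  have h : (S.sort (· ≤ ·)).length = S.card := Finset.length_sort _
  refine ⟨fun a => (S.sort (· ≤ ·)).get (Fin.cast h.symm a), ?_⟩
  unfold orderedMonomial
  congr 1
  refine List.ext_getElem (by simp) fun n h1 h2 => ?_
  simp

/-- Straightening: `x_j` is moved past the minimum of `S` until it meets a larger index or itself.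
It makes the formal basis act as predicted in every algebra with these relations. -/
theorem mul_orderedMonomial {q : ι → ι → K} {x : ι → B}
    (hx : ∀ i j, x i * x j = -(q i j • (x j * x i))) (hsq : ∀ i, x i * x i = 0)
    (j : ι) (S : Finset ι) :
    x j * orderedMonomial x S =
      if j ∈ S then 0 else reorderCoeff q j S • orderedMonomial x (insert j S) := by
  induction S using Finset.induction_on_min with
  | empty => simp [orderedMonomial, reorderCoeff]
  | insert a S ha ih =>
    have haS : a ∉ S := notMem_of_forall_lt ha
    rcases lt_trichotomy j a with h | rfl | h
    · have hj : ∀ b ∈ insert a S, j < b := by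
        intro b hb
        rcases Finset.mem_insert.mp hb with rfl | hb
        exacts [h, h.trans (ha b hb)]
      rw [if_neg (notMem_of_forall_lt hj), orderedMonomial_insert x hj,
        reorderCoeff_of_forall_lt q hj, one_smul]
    · rw [if_pos (Finset.mem_insert_self _ _), orderedMonomial_insert x ha, ← mul_assoc, hsq,
        zero_mul]
    · rw [orderedMonomial_insert x ha, ← mul_assoc, hx, neg_mul, smul_mul_assoc, mul_assoc, ih]
      by_cases hj : j ∈ S
      · simp [hj]
      · have hj' : j ∉ insert a S := by simp [hj, h.ne']
        have ha' : ∀ b ∈ insert j S, a < b := by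
          intro b hb
          rcases Finset.mem_insert.mp hb with rfl | hb
          exacts [h, ha b hb]
        rw [if_neg hj, if_neg hj', Finset.insert_comm j a, orderedMonomial_insert x ha',
          reorderCoeff_insert_of_lt q haS h, mul_smul_comm, smul_smul, neg_mul, neg_smul]

end QuantumExterior

/-! ### The Boolean `sl₂`-action -/

section PairOperators

open Finsupp

variable {K : Type*} [Field K] {r : ℕ}

/-- The indices `i` and `-i`. -/
def idxPair (l : Fin r) : Finset (Idx r) := {Sum.inl l, Sum.inr l}

theorem idxPair_disjoint {l m : Fin r} (h : l ≠ m) : Disjoint (idxPair l) (idxPair m) := by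
  simp [idxPair, h, Finset.disjoint_left]

theorem card_idxPair (l : Fin r) : (idxPair l).card = 2 := by simp [idxPair]

/-- The operator that adds the indices `l, -l` to a set, with coefficients `a`. -/
noncomputable def pairUp (a : Fin r → Finset (Idx r) → K) (l : Fin r) : Module.End K (Finset (Idx r) →₀ K) :=
  linearCombination K fun S => if Disjoint (idxPair l) S then single (S ∪ idxPair l) (a l S) else 0

/-- The operator that removes the indices `l, -l` from a set, with coefficients inverse to `a`. -/
noncomputable def pairDown (a : Fin r → Finset (Idx r) → K) (l : Fin r) : Module.End K (Finset (Idx r) →₀ K) :=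
  linearCombination K fun S =>
    if idxPair l ⊆ S then single (S \ idxPair l) (a l (S \ idxPair l))⁻¹ else 0

/-- The grading operator, shifted by `r`. -/
noncomputable def pairWeight (K : Type*) [Field K] (r : ℕ) : Module.End K (Finset (Idx r) →₀ K) :=
  linearCombination K fun S => single S ((S.card : K) - r)

theorem pairUp_single (a : Fin r → Finset (Idx r) → K) (l : Fin r) (S : Finset (Idx r)) (b : K) :
    pairUp a l (single S b) =
      if Disjoint (idxPair l) S then single (S ∪ idxPair l) (b * a l S) else 0 := by
  simp [pairUp, linearCombination_single]

theorem pairDown_single (a : Fin r → Finset (Idx r) → K) (l : Fin r) (S : Finset (Idx r)) (b : K) :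
    pairDown a l (single S b) =
      if idxPair l ⊆ S then single (S \ idxPair l) (b * (a l (S \ idxPair l))⁻¹) else 0 := by
  simp [pairDown, linearCombination_single]

theorem pairWeight_single (S : Finset (Idx r)) (b : K) :
    pairWeight K r (single S b) = single S (b * ((S.card : K) - r)) := by
  rw [pairWeight, linearCombination_single, smul_single, smul_eq_mul]

/-- `hcomm` says that adding two different pairs commutes. Applied to `S \ idxPair m`, it becomes
the equality of the coefficients here, since removal uses inverse coefficients. -/
theorem pairUp_pairDown_comm {a : Fin r → Finset (Idx r) → K} (ha : ∀ l S, a l S ≠ 0)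
    {l m : Fin r} (hlm : l ≠ m)
    (hcomm : ∀ S, Disjoint (idxPair l) S → Disjoint (idxPair m) S →
      a l S * a m (S ∪ idxPair l) = a m S * a l (S ∪ idxPair m)) :
    pairUp a l * pairDown a m = pairDown a m * pairUp a l := by
  have hd := idxPair_disjoint hlm
  refine Finsupp.lhom_ext fun S b => ?_
  simp only [Module.End.mul_apply, pairUp_single, pairDown_single]
  by_cases hm : idxPair m ⊆ S
  · have h1 : Disjoint (idxPair l) (S \ idxPair m) ↔ Disjoint (idxPair l) S := by
      rw [Finset.disjoint_left, Finset.disjoint_left]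
      refine forall₂_congr fun x hx => ?_
      simp [Finset.disjoint_left.mp hd hx]
    rw [if_pos hm, pairUp_single]
    by_cases hl : Disjoint (idxPair l) S
    · have h2 : (S ∪ idxPair l) \ idxPair m = S \ idxPair m ∪ idxPair l := by
        rw [Finset.union_sdiff_distrib, Finset.sdiff_eq_self_of_disjoint hd]
      rw [if_pos (h1.mpr hl), if_pos hl, pairDown_single,
        if_pos (hm.trans Finset.subset_union_left), h2]
      congr 1
      have h3 := hcomm (S \ idxPair m) (h1.mpr hl) Finset.disjoint_sdiff
      rw [Finset.sdiff_union_of_subset hm] at h3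
      have h4 := ha m (S \ idxPair m)
      have h5 := ha m (S \ idxPair m ∪ idxPair l)
      field_simp
      linear_combination b * h3
    · rw [if_neg (fun h => hl (h1.mp h)), if_neg hl, map_zero]
  · rw [if_neg hm, map_zero]
    by_cases hl : Disjoint (idxPair l) S
    · rw [if_pos hl, pairDown_single, if_neg]
      intro h
      refine hm fun x hx => ?_
      rcases Finset.mem_union.mp (h hx) with h' | h'
      exacts [h', absurd hx (Finset.disjoint_left.mp hd h')]
    · rw [if_neg hl, map_zero]

/-- Only `S ∩ {l, -l}` matters: the value is `1`, `0` or `-1` when it has two, one or no elements.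
Summed over `l` this gives `|S| - r`. -/
theorem commutator_pairUp_pairDown_single {a : Fin r → Finset (Idx r) → K} (ha : ∀ l S, a l S ≠ 0)
    (l : Fin r) (S : Finset (Idx r)) (b : K) :
    (pairUp a l * pairDown a l - pairDown a l * pairUp a l) (single S b) = single S
      (b * ((if Sum.inl l ∈ S then 1 else 0) + (if Sum.inr l ∈ S then 1 else 0) - 1)) := by
  rw [LinearMap.sub_apply, Module.End.mul_apply, Module.End.mul_apply, pairUp_single,
    pairDown_single]
  have hsub : idxPair l ⊆ S ↔ Sum.inl l ∈ S ∧ Sum.inr l ∈ S := by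
    simp [idxPair, Finset.insert_subset_iff]
  have hdis : Disjoint (idxPair l) S ↔ Sum.inl l ∉ S ∧ Sum.inr l ∉ S := by
    simp [idxPair]
  have hup : idxPair l ⊆ S → pairUp a l (single (S \ idxPair l) (b * (a l (S \ idxPair l))⁻¹)) =
      single S b := by
    intro h
    rw [pairUp_single, if_pos Finset.disjoint_sdiff, Finset.sdiff_union_of_subset h, mul_assoc,
      inv_mul_cancel₀ (ha _ _), mul_one]
  have hdown : Disjoint (idxPair l) S → pairDown a l (single (S ∪ idxPair l) (b * a l S)) =
      single S b := by
    intro h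
    rw [pairDown_single, if_pos Finset.subset_union_right, Finset.union_sdiff_cancel_right h.symm,
      mul_assoc, mul_inv_cancel₀ (ha _ _), mul_one]
  by_cases h1 : Sum.inl l ∈ S <;> by_cases h2 : Sum.inr l ∈ S
  · rw [if_pos (hsub.mpr ⟨h1, h2⟩), if_neg (fun h => (hdis.mp h).1 h1), hup (hsub.mpr ⟨h1, h2⟩)]
    simp [h1, h2]
  · rw [if_neg (fun h => h2 (hsub.mp h).2), if_neg (fun h => (hdis.mp h).1 h1)]
    simp [h1, h2]
  · rw [if_neg (fun h => h1 (hsub.mp h).1), if_neg (fun h => (hdis.mp h).2 h2)]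
    simp [h1, h2]
  · rw [if_neg (fun h => h1 (hsub.mp h).1), if_pos (hdis.mpr ⟨h1, h2⟩), hdown (hdis.mpr ⟨h1, h2⟩)]
    simp [h1, h2]

theorem sum_commutator_sum {R κ : Type*} [Ring R] [Fintype κ] {u d : κ → R}
    (h : ∀ l m, l ≠ m → u l * d m = d m * u l) :
    (∑ l, u l) * (∑ l, d l) - (∑ l, d l) * (∑ l, u l) = ∑ l, (u l * d l - d l * u l) := by
  rw [Finset.sum_mul_sum, Finset.sum_mul_sum, Finset.sum_comm, ← Finset.sum_sub_distrib]
  refine Finset.sum_congr rfl fun m _ => ?_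
  rw [← Finset.sum_sub_distrib]
  exact Finset.sum_eq_single m (fun l _ hl => by rw [h l m hl, sub_self]) (by simp)

theorem commutator_sum_of_forall {R κ : Type*} [Ring R] [Fintype κ] {w : R} {u : κ → R} (n : ℕ)
    (h : ∀ l, w * u l - u l * w = (n : ℤ) • u l) :
    w * (∑ l, u l) - (∑ l, u l) * w = n • ∑ l, u l := by
  rw [Finset.mul_sum, Finset.sum_mul, ← Finset.sum_sub_distrib, Finset.smul_sum]
  exact Finset.sum_congr rfl fun l _ => (h l).trans (natCast_zsmul _ _)

theorem commutator_sum_of_forall_neg {R κ : Type*} [Ring R] [Fintype κ] {w : R} {u : κ → R} (n : ℕ)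
    (h : ∀ l, w * u l - u l * w = (-n : ℤ) • u l) :
    w * (∑ l, u l) - (∑ l, u l) * w = -(n • ∑ l, u l) := by
  rw [Finset.mul_sum, Finset.sum_mul, ← Finset.sum_sub_distrib, Finset.smul_sum,
    ← Finset.sum_neg_distrib]
  exact Finset.sum_congr rfl fun l _ => by rw [h l, neg_zsmul, natCast_zsmul]

theorem sum_pairUp_commutator {a : Fin r → Finset (Idx r) → K} (ha : ∀ l S, a l S ≠ 0)
    (hcomm : ∀ l m S, l ≠ m → Disjoint (idxPair l) S → Disjoint (idxPair m) S →
      a l S * a m (S ∪ idxPair l) = a m S * a l (S ∪ idxPair m)) :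
    (∑ l, pairUp a l) * (∑ l, pairDown a l) - (∑ l, pairDown a l) * (∑ l, pairUp a l) =
      pairWeight K r := by
  refine (sum_commutator_sum (u := pairUp a) (d := pairDown a) fun l m hlm =>
    pairUp_pairDown_comm ha hlm fun S => hcomm l m S hlm).trans ?_
  refine Finsupp.lhom_ext fun S b => ?_
  rw [LinearMap.sum_apply, Finset.sum_congr rfl fun l _ =>
    commutator_pairUp_pairDown_single ha l S b, pairWeight_single, ← Finsupp.single_finsetSum,
    ← Finset.mul_sum, Finset.sum_sub_distrib, Finset.sum_add_distrib,
    ← Fintype.sum_sum_type (fun i : Idx r => if i ∈ S then (1 : K) else 0)]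
  simp

theorem pairWeight_commutator_pairUp (a : Fin r → Finset (Idx r) → K) (l : Fin r) :
    pairWeight K r * pairUp a l - pairUp a l * pairWeight K r = (2 : ℤ) • pairUp a l := by
  refine Finsupp.lhom_ext fun S b => ?_
  rw [LinearMap.sub_apply, Module.End.mul_apply, Module.End.mul_apply,
    LinearMap.smul_apply, pairWeight_single, pairUp_single, pairUp_single]
  by_cases h : Disjoint (idxPair l) S
  · rw [if_pos h, if_pos h, pairWeight_single, ← Finsupp.single_sub, Finsupp.smul_single,
      Finset.card_union_of_disjoint h.symm, card_idxPair]
    congr 1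
    push_cast
    simp only [zsmul_eq_mul]
    push_cast
    ring
  · simp [h]

theorem pairWeight_commutator_pairDown (a : Fin r → Finset (Idx r) → K) (l : Fin r) :
    pairWeight K r * pairDown a l - pairDown a l * pairWeight K r = (-2 : ℤ) • pairDown a l := by
  refine Finsupp.lhom_ext fun S b => ?_
  rw [LinearMap.sub_apply, Module.End.mul_apply, Module.End.mul_apply,
    LinearMap.smul_apply, pairWeight_single, pairDown_single,
    pairDown_single]
  by_cases h : idxPair l ⊆ S
  · have h2 : S.card = (S \ idxPair l).card + 2 := by
      rw [← card_idxPair l, Finset.card_sdiff_add_card_eq_card h]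
    rw [if_pos h, if_pos h, pairWeight_single, ← Finsupp.single_sub, Finsupp.smul_single,
      h2]
    congr 1
    push_cast
    simp only [zsmul_eq_mul]
    push_cast
    ring
  · simp [h]

attribute [local instance] LieRing.ofAssociativeRing

theorem isSl2Triple_pairWeight [CharZero K] (hr : 1 ≤ r) {a : Fin r → Finset (Idx r) → K}
    (ha : ∀ l S, a l S ≠ 0)
    (hcomm : ∀ l m S, l ≠ m → Disjoint (idxPair l) S → Disjoint (idxPair m) S →
      a l S * a m (S ∪ idxPair l) = a m S * a l (S ∪ idxPair m)) :
    IsSl2Triple (pairWeight K r) (∑ l, pairUp a l) (∑ l, pairDown a l) where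
  h_ne_zero := by
    intro h
    -- The empty set has weight `-r`, which is nonzero.
    have h1 := DFunLike.congr_fun (DFunLike.congr_fun h (single ∅ 1)) ∅
    rw [pairWeight_single] at h1
    simp at h1
    omega
  lie_e_f := sum_pairUp_commutator ha hcomm
  lie_h_e_nsmul :=
    commutator_sum_of_forall (u := pairUp a) 2 (pairWeight_commutator_pairUp a)
  lie_h_f_nsmul :=
    commutator_sum_of_forall_neg (u := pairDown a) 2 (pairWeight_commutator_pairDown a)

/-- The space is finite-dimensional, so the weight of a primitive vector is a natural number,
whereas `k - r` is negative. -/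
theorem eq_zero_of_sum_pairUp_eq_zero [CharZero K] (hr : 1 ≤ r) {a : Fin r → Finset (Idx r) → K}
    (ha : ∀ l S, a l S ≠ 0)
    (hcomm : ∀ l m S, l ≠ m → Disjoint (idxPair l) S → Disjoint (idxPair m) S →
      a l S * a m (S ∪ idxPair l) = a m S * a l (S ∪ idxPair m))
    {k : ℕ} (hk : k < r) {v : Finset (Idx r) →₀ K}
    (hv : pairWeight K r v = ((k : K) - r) • v) (h0 : (∑ l, pairUp a l) v = 0) : v = 0 := by
  by_contra hne
  have P : IsSl2Triple.HasPrimitiveVectorWith (isSl2Triple_pairWeight hr ha hcomm) v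
      ((k : K) - r) := ⟨hne, hv, h0⟩
  obtain ⟨n, hn⟩ := P.exists_nat
  have : (k : K) = ((n + r : ℕ) : K) := by push_cast; linear_combination hn
  have := Nat.cast_injective this
  omega

end PairOperators

/-! ### Generators and relations -/

section QuadAlg

variable {K : Type*} [Field K] {ι : Type*} [Fintype ι] (R : Matrix (ι × ι) (ι × ι) K)

theorem QuadAlg.gen_relation (c : ι × ι) :
    ∑ p : ι × ι, R c p • (QuadAlg.gen R p.1 * QuadAlg.gen R p.2) = 0 := by
  have h := RingQuot.mkAlgHom_rel K (QuadRel.row (R := R) c)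
  simpa [QuadAlg.gen, map_sum, map_smul, map_mul] using h

/-- The homomorphism from the quadratic algebra given by elements that satisfy the relations. -/
noncomputable def QuadAlg.lift {B : Type*} [Ring B] [Algebra K B] (x : ι → B)
    (hx : ∀ c, ∑ p : ι × ι, R c p • (x p.1 * x p.2) = 0) : QuadAlg R →ₐ[K] B :=
  RingQuot.liftAlgHom K ⟨FreeAlgebra.lift K x, by
    rintro _ _ ⟨c⟩
    simpa [map_sum, map_smul, map_mul] using hx c⟩

theorem QuadAlg.lift_gen {B : Type*} [Ring B] [Algebra K B] (x : ι → B)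
    (hx : ∀ c, ∑ p : ι × ι, R c p • (x p.1 * x p.2) = 0) (i : ι) :
    QuadAlg.lift R x hx (QuadAlg.gen R i) = x i := by
  simp [QuadAlg.lift, QuadAlg.gen]

theorem QuadAlg.monomial_cons {k : ℕ} (i : ι) (I : Fin k → ι) :
    QuadAlg.monomial R (Fin.cons i I : Fin (k + 1) → ι) =
      QuadAlg.gen R i * QuadAlg.monomial R I := by
  simp [QuadAlg.monomial, List.ofFn_succ]

theorem QuadAlg.component_eq_bot_iff {k : ℕ} :
    QuadAlg.component R k = ⊥ ↔ ∀ I : Fin k → ι, QuadAlg.monomial R I = 0 := by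
  simp [QuadAlg.component, Submodule.span_eq_bot]

theorem QuadAlg.component_eq_bot_of_le {k m : ℕ} (h : QuadAlg.component R k = ⊥) (hkm : k ≤ m) :
    QuadAlg.component R m = ⊥ := by
  induction m, hkm using Nat.le_induction with
  | base => exact h
  | succ m _ ih =>
    rw [QuadAlg.component_eq_bot_iff] at ih ⊢
    intro I
    rw [← Fin.cons_self_tail I, QuadAlg.monomial_cons, ih, mul_zero]

end QuadAlg

/-! ### The relations of `Ξ_{C_q}`: q-commutation and `Ω = 0` -/

section Relations

variable {K : Type*} [Field K] {r : ℕ}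

theorem Idx.eq_opp_comm {i j : Idx r} : i = j.opp ↔ j = i.opp := by
  constructor <;> rintro rfl <;> simp

theorem Idx.sgn_opp (i : Idx r) : i.opp.sgn K = -i.sgn K := by
  rcases i with i | i <;> simp [Idx.sgn]

theorem Idx.sgn_mul_self (i : Idx r) : i.sgn K * i.sgn K = 1 := by
  rcases i with i | i <;> simp [Idx.sgn]

variable (q : ParamFamily K r)

theorem ParamFamily.qm_mul_qm (i j : Idx r) : q.qm i j * q.qm j i = 1 := by
  rw [q.qm_symm i j, inv_mul_cancel₀ (q.qm_ne_zero j i)]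

theorem ParamFamily.qm_mul_qm_opp (i j : Idx r) : q.qm i j * q.qm i.opp j = q.qv j ^ 2 := by
  rw [q.qm_opp, ← mul_assoc, mul_inv_cancel₀ (q.qm_ne_zero i j), one_mul]

theorem ParamFamily.qm_mul_qm_opp_right (i j : Idx r) :
    q.qm j i * q.qm j i.opp = (q.qv j ^ 2)⁻¹ := by
  rw [q.qm_symm j, q.qm_symm j i.opp, ← mul_inv, q.qm_mul_qm_opp]

theorem ParamFamily.qm_opp_right (i : Idx r) : q.qm i i.opp = (q.qv i ^ 2)⁻¹ := by
  rw [← q.qm_mul_qm_opp_right i i, q.qm_diag, one_mul]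

variable {B : Type*} [Ring B] [Algebra K B]

theorem sum_opP (x : Idx r → B) (c : Idx r × Idx r) :
    ∑ p, opP q p c • (x p.1 * x p.2) = q.qm c.1 c.2 • (x c.2 * x c.1) := by
  rw [Finset.sum_eq_single (c.2, c.1)]
  · simp [opP]
  · intro p _ hp
    rw [opP, if_neg, zero_smul]
    exact fun h => hp (Prod.ext h.1 h.2)
  · simp

theorem sum_opQ (x : Idx r → B) (c : Idx r × Idx r) :
    ∑ p, opQ q p c • (x p.1 * x p.2) = if c.1 = c.2.opp then
      (c.1.sgn K * (q.qv c.1)⁻¹) • ∑ i : Idx r, (i.sgn K * q.qv i) • (x i * x i.opp) else 0 := by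
  split_ifs with h
  · rw [Fintype.sum_prod_type, Finset.smul_sum]
    refine Finset.sum_congr rfl fun i _ => ?_
    rw [Finset.sum_eq_single i.opp]
    · rw [opQ, if_pos ⟨by simp, h⟩, smul_smul]
      congr 1
      ring
    · intro j _ hj
      rw [opQ, if_neg, zero_smul]
      exact fun h' => hj (Idx.eq_opp_comm.mp h'.1)
    · simp
  · exact Finset.sum_eq_zero fun p _ => by rw [opQ, if_neg (fun h' => h h'.2), zero_smul]

/-- The terms of `l` and `-l` agree: `q_{l,-l} = q_l⁻²` gives `-q_l⁻¹ x_{-l} x_l = q_l x_l x_{-l}`.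
-/
theorem sum_sgn_eq (x : Idx r → B) (hx : ∀ i j, x i * x j = -(q.qm i j • (x j * x i))) :
    ∑ i : Idx r, (i.sgn K * q.qv i) • (x i * x i.opp) =
      (2 : K) • ∑ l : Fin r, q.qv (Sum.inl l) • (x (Sum.inl l) * x (Sum.inr l)) := by
  rw [Fintype.sum_sum_type, ← Finset.sum_add_distrib, Finset.smul_sum]
  refine Finset.sum_congr rfl fun l _ => ?_
  have h1 := hx (Sum.inl l) (Sum.inr l)
  have h2 := q.qm_opp_right (Sum.inl l)
  have h3 := q.qv_opp (Sum.inl l)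
  have h4 := q.qv_ne_zero (Sum.inl l)
  simp only [Idx.opp, Sum.swap_inl] at h2 h3
  simp only [Idx.opp, Sum.swap_inl, Sum.swap_inr, Idx.sgn, Sum.elim_inl, Sum.elim_inr, h3]
  rw [h1, h2, smul_neg, smul_neg, smul_neg, smul_smul, smul_smul, smul_smul, ← neg_smul,
    ← neg_smul, ← add_smul]
  congr 1
  field_simp
  ring

theorem sum_one_sub_opC [CharZero K] (x : Idx r → B) (c : Idx r × Idx r) :
    ∑ p, (1 - opC q).transpose c p • (x p.1 * x p.2) =
      (2 : K)⁻¹ • (x c.1 * x c.2 + q.qm c.1 c.2 • (x c.2 * x c.1)) + (2 * (r : K))⁻¹ •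
        (if c.1 = c.2.opp then (c.1.sgn K * (q.qv c.1)⁻¹) •
          ∑ i : Idx r, (i.sgn K * q.qv i) • (x i * x i.opp) else 0) := by
  have h : ∀ p, (1 - opC q).transpose c p • (x p.1 * x p.2) =
      (2 : K)⁻¹ • ((1 : Matrix (Idx r × Idx r) (Idx r × Idx r) K) p c • (x p.1 * x p.2)) +
      (2 : K)⁻¹ • (opP q p c • (x p.1 * x p.2)) +
      (2 * (r : K))⁻¹ • (opQ q p c • (x p.1 * x p.2)) := by
    intro p
    rw [smul_smul, smul_smul, smul_smul, ← add_smul, ← add_smul]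
    congr 1
    simp only [opC, Matrix.transpose_apply, Matrix.sub_apply, Matrix.smul_apply, smul_eq_mul]
    ring
  have h1 : ∑ p, (1 : Matrix (Idx r × Idx r) (Idx r × Idx r) K) p c • (x p.1 * x p.2) = x c.1 * x c.2 := by
    simp [Matrix.one_apply]
  rw [Finset.sum_congr rfl fun p _ => h p, Finset.sum_add_distrib, Finset.sum_add_distrib,
    ← Finset.smul_sum, ← Finset.smul_sum, ← Finset.smul_sum, h1, sum_opP, sum_opQ, ← smul_add]

theorem quadRelations_iff [CharZero K] (hr : 1 ≤ r) (x : Idx r → B) :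
    (∀ c, ∑ p, (1 - opC q).transpose c p • (x p.1 * x p.2) = 0) ↔
      (∀ i j, x i * x j = -(q.qm i j • (x j * x i))) ∧
        ∑ l : Fin r, q.qv (Sum.inl l) • (x (Sum.inl l) * x (Sum.inr l)) = 0 := by
  have h2 : (2 : K) ≠ 0 := two_ne_zero
  have hr' : (2 * (r : K))⁻¹ ≠ 0 := inv_ne_zero (mul_ne_zero h2 (by exact_mod_cast (by omega)))
  simp_rw [sum_one_sub_opC]
  constructor
  · intro h
    have hΩ : ∑ i : Idx r, (i.sgn K * q.qv i) • (x i * x i.opp) = 0 := by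
      set i : Idx r := Sum.inl ⟨0, hr⟩ with hi
      have e1 := h (i, i.opp)
      have e2 := h (i.opp, i)
      set Ω := ∑ i : Idx r, (i.sgn K * q.qv i) • (x i * x i.opp)
      rw [if_pos (by simp)] at e1
      rw [if_pos rfl] at e2
      simp only [Idx.sgn_opp, q.qv_opp] at e2
      have hs : q.qm i.opp i = q.qv i ^ 2 := by
        have := q.qm_mul_qm_opp i i
        rwa [q.qm_diag, one_mul] at this
      simp only [hs, q.qm_opp_right] at e1 e2
      have hq := q.qv_ne_zero i
      -- After scaling by `q_i` and `q_i⁻¹`, the relations for `(i, -i)` and `(-i, i)` have the same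
      -- q-symmetric part but opposite multiples of `Ω`; their difference isolates `Ω`.
      have e3 : (2 * (r : K))⁻¹ • ((2 * i.sgn K) • Ω) = 0 := by
        have e4 := congrArg₂ (fun a b => q.qv i • a - (q.qv i)⁻¹ • b) e1 e2
        simp only [smul_zero, sub_zero] at e4
        refine Eq.trans ?_ e4
        match_scalars <;> field_simp <;> ring
      have hsgn : (2 * i.sgn K : K) ≠ 0 :=
        mul_ne_zero h2 (left_ne_zero_of_mul_eq_one (Idx.sgn_mul_self i))
      exact (smul_eq_zero.mp ((smul_eq_zero.mp e3).resolve_left hr')).resolve_left hsgn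
    rw [hΩ] at h
    have hcomm : ∀ i j, x i * x j = -(q.qm i j • (x j * x i)) := by
      intro i j
      have h' := h (i, j)
      rw [smul_zero, ite_self, smul_zero, add_zero] at h'
      exact eq_neg_of_add_eq_zero_left ((smul_eq_zero.mp h').resolve_left (inv_ne_zero h2))
    refine ⟨hcomm, ?_⟩
    rw [sum_sgn_eq q x hcomm] at hΩ
    exact (smul_eq_zero.mp hΩ).resolve_left h2
  · rintro ⟨hcomm, hΩ⟩ c
    rw [sum_sgn_eq q x hcomm, hΩ, hcomm c.1 c.2]
    simp

theorem mul_self_eq_zero_of_comm [CharZero K] {x : Idx r → B}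
    (hx : ∀ i j, x i * x j = -(q.qm i j • (x j * x i))) (i : Idx r) : x i * x i = 0 := by
  have h := hx i i
  rw [q.qm_diag, one_smul, eq_neg_iff_add_eq_zero, ← two_smul K] at h
  exact (smul_eq_zero.mp h).resolve_left two_ne_zero

/-- The two signs cancel and `q_ji q_{j,-i} = q_j⁻²` does not depend on `i`. This is why `Ω`
commutes with each generator up to a scalar. -/
theorem mul_pair_comm {x : Idx r → B} (hx : ∀ i j, x i * x j = -(q.qm i j • (x j * x i)))
    (j i : Idx r) :
    x j * (x i * x i.opp) = (q.qv j ^ 2)⁻¹ • (x i * x i.opp * x j) := by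
  rw [← mul_assoc, hx j i, neg_mul, smul_mul_assoc, mul_assoc, hx j i.opp, mul_neg, smul_neg,
    neg_neg, mul_smul_comm, smul_smul, q.qm_mul_qm_opp_right, mul_assoc]

theorem pair_commute {x : Idx r → B} (hx : ∀ i j, x i * x j = -(q.qm i j • (x j * x i)))
    (i j : Idx r) : x j * x j.opp * (x i * x i.opp) = x i * x i.opp * (x j * x j.opp) := by
  rw [mul_assoc, mul_pair_comm q hx j.opp i, mul_smul_comm, ← mul_assoc, mul_pair_comm q hx j i,
    smul_mul_assoc, smul_smul, q.qv_opp, inv_pow, inv_inv, mul_inv_cancel₀, one_smul, mul_assoc]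
  exact pow_ne_zero 2 (q.qv_ne_zero j)

end Relations

/-! ### The action of `Ω` on the graded quantum exterior algebra -/

section Model

open Finsupp

variable {K : Type*} [Field K] {r : ℕ}

/-- The lexicographic order on the indices. -/
abbrev idxLinearOrder (r : ℕ) : LinearOrder (Idx r) :=
  let o := LinearOrder.lift' (toLex : Idx r → Fin r ⊕ₗ Fin r) toLex.injective
  { o with
    -- Decidable equality is that of the sum type, so that `insert` and `∪` on sets of indices agree
    -- with those of the order-free pair operators.
    toDecidableEq := instDecidableEqSum
    compare_eq_compareOfLessAndEq := fun a b => by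
      rw [o.compare_eq_compareOfLessAndEq]
      congr 1 }

attribute [local instance] idxLinearOrder

variable (q : ParamFamily K r)

/-- The action of `ψ_i` on the quantum exterior algebra. -/
noncomputable def psiOp (i : Idx r) : Module.End K (Finset (Idx r) →₀ K) := leftMul q.qm i

theorem psiOp_comm (i j : Idx r) :
    psiOp q i * psiOp q j = -(q.qm i j • (psiOp q j * psiOp q i)) :=
  leftMul_mul_leftMul q.qm_mul_qm i j

/-- The coefficient of `q_l ψ_l ψ_{-l}` on the increasing monomials. -/
def pairCoeff (l : Fin r) (S : Finset (Idx r)) : K :=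
  q.qv (Sum.inl l) * reorderCoeff q.qm (Sum.inr l) S *
    reorderCoeff q.qm (Sum.inl l) (insert (Sum.inr l) S)

theorem pairCoeff_ne_zero (l : Fin r) (S : Finset (Idx r)) : pairCoeff q l S ≠ 0 :=
  mul_ne_zero (mul_ne_zero (q.qv_ne_zero _) (reorderCoeff_ne_zero q.qm_ne_zero _ _))
    (reorderCoeff_ne_zero q.qm_ne_zero _ _)

theorem pairUp_pairCoeff (l : Fin r) :
    pairUp (pairCoeff q) l =
      q.qv (Sum.inl l) • (psiOp q (Sum.inl l) * psiOp q (Sum.inr l)) := by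
  refine Finsupp.lhom_ext fun S b => ?_
  rw [LinearMap.smul_apply, Module.End.mul_apply, pairUp_single, psiOp, psiOp, leftMul_single]
  by_cases h2 : Sum.inr l ∈ S
  · rw [if_neg (by simp [idxPair, h2]), if_pos h2, map_zero, smul_zero]
  rw [if_neg h2, leftMul_single]
  by_cases h1 : Sum.inl l ∈ S
  · rw [if_neg (by simp [idxPair, h1]), if_pos (Finset.mem_insert_of_mem h1), smul_zero]
  · rw [if_pos (by simp [idxPair, h1, h2]), if_neg (by simp [h1]), smul_single, smul_eq_mul]
    congr 1
    · ext x
      simp [idxPair]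
    · simp only [pairCoeff, mul_assoc, mul_left_comm b]

/-- Read off from the commuting operators `ψ_l ψ_{-l}`, which avoids any comparison of the
reordering products. -/
theorem pairCoeff_comm (l m : Fin r) (S : Finset (Idx r)) (hlm : l ≠ m)
    (hl : Disjoint (idxPair l) S) (hm : Disjoint (idxPair m) S) :
    pairCoeff q l S * pairCoeff q m (S ∪ idxPair l) =
      pairCoeff q m S * pairCoeff q l (S ∪ idxPair m) := by
  have h : pairUp (pairCoeff q) m * pairUp (pairCoeff q) l =
      pairUp (pairCoeff q) l * pairUp (pairCoeff q) m := by
    have h1 := pair_commute (B := Module.End K (Finset (Idx r) →₀ K)) q (psiOp_comm q) (Sum.inl l) (Sum.inl m)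
    simp only [Idx.opp, Sum.swap_inl] at h1
    rw [pairUp_pairCoeff, pairUp_pairCoeff, smul_mul_smul_comm, smul_mul_smul_comm, h1, mul_comm]
  have h2 := LinearMap.congr_fun h (single S 1)
  have hd := idxPair_disjoint hlm
  rw [Module.End.mul_apply, Module.End.mul_apply, pairUp_single, if_pos hl, pairUp_single,
    if_pos (Finset.disjoint_union_right.mpr ⟨hm, hd.symm⟩), pairUp_single, if_pos hm,
    pairUp_single, if_pos (Finset.disjoint_union_right.mpr ⟨hl, hd⟩),
    Finset.union_right_comm] at h2
  simpa using Finsupp.single_injective _ h2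

/-- The action of `∑ q_l ψ_l ψ_{-l}`. -/
noncomputable def omegaOp : Module.End K (Finset (Idx r) →₀ K) := ∑ l, pairUp (pairCoeff q) l

theorem omegaOp_eq : omegaOp q = ∑ l : Fin r,
    q.qv (Sum.inl l) • (psiOp q (Sum.inl l) * psiOp q (Sum.inr l)) :=
  Finset.sum_congr rfl fun l _ => pairUp_pairCoeff q l

theorem psiOp_mul_omegaOp (j : Idx r) :
    psiOp q j * omegaOp q = (q.qv j ^ 2)⁻¹ • (omegaOp q * psiOp q j) := by
  rw [omegaOp_eq, Finset.mul_sum, Finset.sum_mul, Finset.smul_sum]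
  refine Finset.sum_congr rfl fun l _ => ?_
  have h := mul_pair_comm (B := Module.End K (Finset (Idx r) →₀ K)) q (psiOp_comm q) j (Sum.inl l)
  simp only [Idx.opp, Sum.swap_inl] at h
  rw [mul_smul_comm, h, smul_mul_assoc, smul_comm]

/-- The component of degree `k` of the quantum exterior algebra. -/
def extDegree (K : Type*) [Field K] (r k : ℕ) : Submodule K (Finset (Idx r) →₀ K) :=
  supported K K {S | S.card = k}

theorem single_mem_extDegree (S : Finset (Idx r)) (b : K) :
    single S b ∈ extDegree K r S.card :=
  single_mem_supported K b rfl

theorem extDegree_eq_span (k : ℕ) :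
    extDegree K r k = Submodule.span K ((fun S => single S (1 : K)) '' {S | S.card = k}) :=
  supported_eq_span_single K _

theorem finrank_extDegree (k : ℕ) : Module.finrank K (extDegree K r k) = (2 * r).choose k := by
  rw [extDegree, (supportedEquivFinsupp _).finrank_eq, Module.finrank_finsupp_self]
  have h := Fintype.card_finset_len (α := Idx r) k
  rw [Fintype.card_sum, Fintype.card_fin, ← two_mul] at h
  rw [← h]
  exact Fintype.card_congr (Equiv.refl _)

theorem pairWeight_of_mem_extDegree {k : ℕ} {v : Finset (Idx r) →₀ K}
    (hv : v ∈ extDegree K r k) : pairWeight K r v = ((k : K) - r) • v := by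
  rw [extDegree_eq_span] at hv
  induction hv using Submodule.span_induction with
  | mem x hx =>
    obtain ⟨S, rfl, rfl⟩ := hx
    dsimp only
    rw [pairWeight_single, smul_single, smul_eq_mul, mul_comm]
  | zero => simp
  | add x y _ _ hx hy => rw [map_add, hx, hy, smul_add]
  | smul a x _ hx => rw [map_smul, hx, smul_comm]

theorem map_extDegree_le {f : Module.End K (Finset (Idx r) →₀ K)} {k m : ℕ}
    (h : ∀ S : Finset (Idx r), S.card = k → f (single S 1) ∈ extDegree K r m)
    {v : Finset (Idx r) →₀ K} (hv : v ∈ extDegree K r k) : f v ∈ extDegree K r m := by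
  rw [extDegree_eq_span] at hv
  refine (Submodule.span_le (p := (extDegree K r m).comap f)).mpr ?_ hv
  rintro _ ⟨S, hS, rfl⟩
  exact h S hS

theorem psiOp_mem_extDegree (i : Idx r) {k : ℕ} {v : Finset (Idx r) →₀ K}
    (hv : v ∈ extDegree K r k) : psiOp q i v ∈ extDegree K r (k + 1) := by
  refine map_extDegree_le (fun S hS => ?_) hv
  rw [psiOp, leftMul_single]
  split_ifs with h
  · exact zero_mem _
  · rw [← hS, ← Finset.card_insert_of_notMem h]
    exact single_mem_extDegree _ _

theorem omegaOp_mem_extDegree {k : ℕ} {v : Finset (Idx r) →₀ K}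
    (hv : v ∈ extDegree K r k) : omegaOp q v ∈ extDegree K r (k + 2) := by
  rw [omegaOp_eq, LinearMap.sum_apply]
  refine sum_mem fun l _ => Submodule.smul_mem _ _ ?_
  exact psiOp_mem_extDegree q _ (psiOp_mem_extDegree q _ hv)

/-- The projection to the component of degree `k`. -/
noncomputable def extProj (K : Type*) [Field K] (r k : ℕ) :
    Module.End K (Finset (Idx r) →₀ K) :=
  linearCombination K fun S => if S.card = k then single S 1 else 0

theorem extProj_of_mem {k m : ℕ} {v : Finset (Idx r) →₀ K} (hv : v ∈ extDegree K r m) :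
    extProj K r k v = if m = k then v else 0 := by
  rw [extDegree_eq_span] at hv
  induction hv using Submodule.span_induction with
  | mem x hx =>
    obtain ⟨S, rfl, rfl⟩ := hx
    simp [extProj, linearCombination_single]
  | zero => simp
  | add x y _ _ hx hy => rw [map_add, hx, hy]; split_ifs <;> simp
  | smul a x _ hx => rw [map_smul, hx]; split_ifs <;> simp

theorem extProj_mem (k : ℕ) (v : Finset (Idx r) →₀ K) : extProj K r k v ∈ extDegree K r k := by
  induction v using Finsupp.induction_linear with
  | zero => simp
  | add f g hf hg => rw [map_add]; exact add_mem hf hg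
  | single S b =>
    rw [extProj_of_mem (single_mem_extDegree S b)]
    split_ifs with h
    · exact h ▸ single_mem_extDegree S b
    · exact zero_mem _

theorem extProj_omegaOp (k : ℕ) (v : Finset (Idx r) →₀ K) :
    extProj K r (k + 2) (omegaOp q v) = omegaOp q (extProj K r k v) := by
  induction v using Finsupp.induction_linear with
  | zero => simp
  | add f g hf hg => simp only [map_add, hf, hg]
  | single S b =>
    have h := single_mem_extDegree S b
    rw [extProj_of_mem h, extProj_of_mem (omegaOp_mem_extDegree q h)]
    by_cases hk : S.card = k <;> simp [hk]

theorem extProj_omegaOp_of_lt {k : ℕ} (hk : k < 2) (v : Finset (Idx r) →₀ K) :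
    extProj K r k (omegaOp q v) = 0 := by
  induction v using Finsupp.induction_linear with
  | zero => simp
  | add f g hf hg => simp only [map_add, hf, hg, add_zero]
  | single S b =>
    rw [extProj_of_mem (omegaOp_mem_extDegree q (single_mem_extDegree S b)), if_neg (by omega)]

/-- `Ω` is homogeneous of degree 2, so a homogeneous element of its image is the image of a
homogeneous component. -/
theorem extDegree_inf_range_omegaOp (k : ℕ) :
    extDegree K r (k + 2) ⊓ LinearMap.range (omegaOp q) =
      (extDegree K r k).map (omegaOp q) := by
  ext v
  constructor
  · rintro ⟨hv, w, rfl⟩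
    refine ⟨extProj K r k w, extProj_mem k w, ?_⟩
    rw [← extProj_omegaOp, extProj_of_mem hv, if_pos rfl]
  · rintro ⟨w, hw, rfl⟩
    exact ⟨omegaOp_mem_extDegree q hw, w, rfl⟩

theorem extDegree_inf_range_omegaOp_of_lt {k : ℕ} (hk : k < 2) :
    extDegree K r k ⊓ LinearMap.range (omegaOp q) = ⊥ := by
  rw [eq_bot_iff]
  rintro v ⟨hv, w, rfl⟩
  rw [Submodule.mem_bot, ← extProj_omegaOp_of_lt q hk w, extProj_of_mem hv, if_pos rfl]

theorem finrank_extDegree_inf_range_omegaOp [CharZero K] (hr : 1 ≤ r) {k : ℕ} (hk : k < r) :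
    Module.finrank K ↥(extDegree K r (k + 2) ⊓ LinearMap.range (omegaOp q)) =
      (2 * r).choose k := by
  have hinj : Function.Injective ((omegaOp q).domRestrict (extDegree K r k)) := by
    rw [injective_iff_map_eq_zero]
    rintro ⟨v, hv⟩ h0
    exact Subtype.ext (eq_zero_of_sum_pairUp_eq_zero hr (pairCoeff_ne_zero q) (pairCoeff_comm q) hk
      (pairWeight_of_mem_extDegree hv) h0)
  rw [extDegree_inf_range_omegaOp, ← LinearMap.range_domRestrict,
    LinearMap.finrank_range_of_inj hinj, finrank_extDegree]

end Model

/-! ### `Ξ_{C_q}` as a quotient of the quantum exterior algebra, and its dimensions -/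

section Iso

open Finsupp

attribute [local instance] idxLinearOrder

variable {K : Type*} [Field K] {r : ℕ} (q : ParamFamily K r)

/-- The generators of `Ξ_{C_q}(K)`. -/
noncomputable abbrev xiGen (i : Idx r) : Xi (opC q) := QuadAlg.gen (1 - opC q).transpose i

theorem xiGen_comm [CharZero K] (hr : 1 ≤ r) (i j : Idx r) : xiGen q i * xiGen q j = -(q.qm i j • (xiGen q j * xiGen q i)) :=
  ((quadRelations_iff q hr (xiGen q)).mp (QuadAlg.gen_relation _)).1 i j

/-- The map from the quantum exterior algebra to `Ξ_{C_q}(K)`. -/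
noncomputable def extToXi : (Finset (Idx r) →₀ K) →ₗ[K] Xi (opC q) :=
  linearCombination K (orderedMonomial (xiGen q))

theorem extToXi_psiOp [CharZero K] (hr : 1 ≤ r) (i : Idx r) (v : Finset (Idx r) →₀ K) :
    extToXi q (psiOp q i v) = xiGen q i * extToXi q v := by
  induction v using Finsupp.induction_linear with
  | zero => simp
  | add f g hf hg => simp only [map_add, hf, hg, mul_add]
  | single S b =>
    rw [psiOp, leftMul_single, extToXi, linearCombination_single, mul_smul_comm,
      mul_orderedMonomial (xiGen_comm q hr) (mul_self_eq_zero_of_comm q (xiGen_comm q hr))]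
    split_ifs
    · simp
    · rw [linearCombination_single, mul_smul]

theorem extToXi_omegaOp [CharZero K] (hr : 1 ≤ r) (v : Finset (Idx r) →₀ K) : extToXi q (omegaOp q v) = 0 := by
  have h := ((quadRelations_iff q hr (xiGen q)).mp (QuadAlg.gen_relation _)).2
  rw [omegaOp_eq, LinearMap.sum_apply, map_sum]
  simp only [LinearMap.smul_apply, Module.End.mul_apply, map_smul, extToXi_psiOp q hr]
  refine Eq.trans (Finset.sum_congr rfl fun l _ => ?_)
    ((Finset.sum_mul _ _ _).symm.trans ((congrArg (· * extToXi q v) h).trans (zero_mul _)))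
  rw [smul_mul_assoc, mul_assoc]

/-- The action of `ψ_i` on the quotient of the quantum exterior algebra by `∑ q_l ψ_l ψ_{-l}`. -/
noncomputable def psiQuot (i : Idx r) :
    Module.End K ((Finset (Idx r) →₀ K) ⧸ LinearMap.range (omegaOp q)) :=
  Submodule.mapQ _ _ (psiOp q i) (by
    rintro _ ⟨v, rfl⟩
    refine ⟨(q.qv i ^ 2)⁻¹ • psiOp q i v, ?_⟩
    rw [map_smul]
    exact (LinearMap.congr_fun (psiOp_mul_omegaOp q i) v).symm)

theorem psiQuot_mk (i : Idx r) (v : Finset (Idx r) →₀ K) :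
    psiQuot q i (Submodule.Quotient.mk v) = Submodule.Quotient.mk (psiOp q i v) := rfl

theorem psiQuot_relations [CharZero K] (hr : 1 ≤ r) (c : Idx r × Idx r) :
    ∑ p, (1 - opC q).transpose c p • (psiQuot q p.1 * psiQuot q p.2) = 0 := by
  refine (quadRelations_iff q hr (psiQuot q)).mpr ⟨fun i j => ?_, ?_⟩ c
  · refine Submodule.linearMap_qext _ (LinearMap.ext fun v => ?_)
    exact congrArg Submodule.Quotient.mk (LinearMap.congr_fun (psiOp_comm q i j) v)
  · refine Submodule.linearMap_qext _ (LinearMap.ext fun v => ?_)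
    have h : (Submodule.Quotient.mk (omegaOp q v) :
        (Finset (Idx r) →₀ K) ⧸ LinearMap.range (omegaOp q)) = 0 :=
      (Submodule.Quotient.mk_eq_zero _).mpr ⟨v, rfl⟩
    rw [LinearMap.comp_apply, LinearMap.sum_apply]
    refine Eq.trans ?_ h
    rw [LinearMap.congr_fun (omegaOp_eq q) v, LinearMap.sum_apply]
    exact (map_sum (LinearMap.range (omegaOp q)).mkQ _ _).symm

/-- The action of `Ξ_{C_q}(K)` on the class of `1`. -/
noncomputable def xiToQuot [CharZero K] (hr : 1 ≤ r) :
    Xi (opC q) →ₗ[K] (Finset (Idx r) →₀ K) ⧸ LinearMap.range (omegaOp q) :=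
  (LinearMap.applyₗ (Submodule.Quotient.mk (single ∅ 1))).comp
    (QuadAlg.lift _ (psiQuot q) (psiQuot_relations q hr)).toLinearMap

theorem xiToQuot_gen_mul [CharZero K] (hr : 1 ≤ r) (i : Idx r) (x : Xi (opC q)) :
    xiToQuot q hr (xiGen q i * x) = psiQuot q i (xiToQuot q hr x) := by
  simp [xiToQuot, QuadAlg.lift_gen]

/-- Increasing monomials are built by multiplying with ever smaller indices on the left, so no
reordering factor appears. -/
theorem xiToQuot_orderedMonomial [CharZero K] (hr : 1 ≤ r) (S : Finset (Idx r)) :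
    xiToQuot q hr (orderedMonomial (xiGen q) S) = Submodule.Quotient.mk (single S 1) := by
  induction S using Finset.induction_on_min with
  | empty => simp [orderedMonomial_empty, xiToQuot]
  | insert a S ha ih =>
    rw [orderedMonomial_insert _ ha, xiToQuot_gen_mul, ih, psiQuot_mk, psiOp, leftMul_single,
      if_neg (notMem_of_forall_lt ha), reorderCoeff_of_forall_lt _ ha,
      mul_one]

theorem xiToQuot_extToXi [CharZero K] (hr : 1 ≤ r) (v : Finset (Idx r) →₀ K) :
    xiToQuot q hr (extToXi q v) = Submodule.Quotient.mk v := by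
  induction v using Finsupp.induction_linear with
  | zero => simp
  | add f g hf hg => rw [map_add, map_add, hf, hg, Submodule.Quotient.mk_add]
  | single S b =>
    rw [extToXi, linearCombination_single, map_smul, xiToQuot_orderedMonomial,
      ← Submodule.Quotient.mk_smul, smul_single, smul_eq_mul, mul_one]

/-- One inclusion is the relation `Ω = 0`; for the other, `xiToQuot` recovers the class of `v`
modulo the image of `Ω` from `extToXi q v`. -/
theorem ker_extToXi [CharZero K] (hr : 1 ≤ r) :
    LinearMap.ker (extToXi q) = LinearMap.range (omegaOp q) := by
  ext v
  constructor
  · intro hv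
    rw [← Submodule.Quotient.mk_eq_zero, ← xiToQuot_extToXi q hr, LinearMap.mem_ker.mp hv, map_zero]
  · rintro ⟨w, rfl⟩
    exact extToXi_omegaOp q hr w

theorem xiComponent_eq_map [CharZero K] (hr : 1 ≤ r) (k : ℕ) :
    Xi.component (opC q) k = (extDegree K r k).map (extToXi q) := by
  refine le_antisymm (Submodule.span_le.mpr ?_) ?_
  · rintro _ ⟨I, rfl⟩
    induction k with
    | zero =>
      refine ⟨single ∅ 1, single_mem_extDegree _ _, ?_⟩
      simp [extToXi, linearCombination_single, orderedMonomial_empty, QuadAlg.monomial]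
    | succ k ih =>
      obtain ⟨v, hv, h⟩ := ih (Fin.tail I)
      refine ⟨psiOp q (I 0) v, psiOp_mem_extDegree q _ hv, ?_⟩
      dsimp only at h ⊢
      rw [extToXi_psiOp q hr, h, ← QuadAlg.monomial_cons, Fin.cons_self_tail]
  · rw [extDegree_eq_span, Submodule.map_span_le]
    rintro _ ⟨S, hS, rfl⟩
    obtain ⟨I, hI⟩ := exists_orderedMonomial_eq (xiGen q) S
    rw [Set.mem_ofPred_eq] at hS
    subst hS
    refine Submodule.subset_span ⟨I, ?_⟩
    rw [extToXi, linearCombination_single, one_smul, hI]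
    rfl

theorem finrank_map_add_finrank_inf_ker {F V W : Type*} [Field F] [AddCommGroup V] [Module F V]
    [FiniteDimensional F V] [AddCommGroup W] [Module F W] (f : V →ₗ[F] W) (p : Submodule F V) :
    Module.finrank F (p.map f) + Module.finrank F ↥(p ⊓ LinearMap.ker f) = Module.finrank F p := by
  rw [← LinearMap.finrank_range_add_finrank_ker (f.domRestrict p), LinearMap.range_domRestrict,
    LinearMap.ker_domRestrict, ← Submodule.map_comap_subtype, Submodule.finrank_map_subtype_eq]

theorem finrank_xiComponent_add [CharZero K] (hr : 1 ≤ r) (k : ℕ) :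
    Module.finrank K (Xi.component (opC q) k) +
      Module.finrank K ↥(extDegree K r k ⊓ LinearMap.range (omegaOp q)) = (2 * r).choose k := by
  rw [xiComponent_eq_map q hr, ← ker_extToXi q hr, ← finrank_extDegree (K := K) k]
  exact finrank_map_add_finrank_inf_ker (W := Xi (opC q)) (extToXi q) (extDegree K r k)

theorem finrank_xiComponent [CharZero K] (hr : 1 ≤ r) {k : ℕ} (hk : 1 ≤ k) (hkr : k ≤ r + 1) :
    (Module.finrank K (Xi.component (opC q) k) : ℚ) =
      (2 * (r : ℚ) - 2 * (k : ℚ) + 2) / (k : ℚ) * ((2 * r + 1).choose (k - 1) : ℚ) := by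
  have h := finrank_xiComponent_add q hr k
  obtain rfl | ⟨j, rfl⟩ : k = 1 ∨ ∃ j, k = j + 2 := by
    rcases k with _ | _ | j
    exacts [absurd hk (by simp), Or.inl rfl, Or.inr ⟨j, rfl⟩]
  · rw [extDegree_inf_range_omegaOp_of_lt q (by norm_num), finrank_bot, add_zero] at h
    rw [h]
    simp
  · rw [finrank_extDegree_inf_range_omegaOp q hr (by omega)] at h
    have h1 : (Module.finrank K (Xi.component (opC q) (j + 2)) : ℚ) =
        (2 * r).choose (j + 2) - (2 * r).choose j := by
      rw [eq_sub_iff_add_eq]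
      exact_mod_cast h
    -- Ratios of consecutive binomials, here and in `h3`; with Pascal's rule for `C(2r+1, j+1)` they
    -- turn the difference into the closed form.
    have h2 : ((2 * r).choose (j + 1) * (j + 1) : ℚ) = (2 * r).choose j * (2 * r - j) := by
      have := Nat.choose_succ_right_eq (2 * r) j
      have h3 := congrArg (Nat.cast (R := ℚ)) this
      push_cast [Nat.cast_sub (show j ≤ 2 * r by omega)] at h3
      exact h3
    have h3 : ((2 * r).choose (j + 2) * (j + 2) : ℚ) =
        (2 * r).choose (j + 1) * (2 * r - (j + 1)) := by
      have := Nat.choose_succ_right_eq (2 * r) (j + 1)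
      have h3 := congrArg (Nat.cast (R := ℚ)) this
      push_cast [Nat.cast_sub (show j + 1 ≤ 2 * r by omega)] at h3
      rw [← h3]
      ring
    rw [h1, show j + 2 - 1 = j + 1 from rfl, Nat.choose_succ_succ]
    push_cast
    have hj : (j : ℚ) + 2 ≠ 0 := by positivity
    field_simp
    linear_combination h3 + h2

theorem xiComponent_eq_bot [CharZero K] (hr : 1 ≤ r) {k : ℕ} (hk : r + 1 ≤ k) :
    Xi.component (opC q) k = ⊥ := by
  refine QuadAlg.component_eq_bot_of_le _ ?_ hk
  have h := finrank_xiComponent q hr (k := r + 1) (by omega) le_rfl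
  have h0 : (2 * (r : ℚ) - 2 * ((r + 1 : ℕ) : ℚ) + 2) = 0 := by push_cast; ring
  rw [h0, zero_div, zero_mul, Nat.cast_eq_zero] at h
  -- Needed because `finrank` is also `0` for infinite-dimensional spaces.
  have : FiniteDimensional K (Xi.component (opC q) (r + 1)) :=
    FiniteDimensional.span_of_finite K (Set.finite_range _)
  exact Submodule.finrank_eq_zero.mp h

end Iso

/-! ### Transposed parameters and the dual algebra -/

section Transpose

variable {K : Type*} [Field K] {r : ℕ}

/-- The parameters of the transposed operators. -/
def ParamFamily.transpose (q : ParamFamily K r) : ParamFamily K r where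
  qm i j := q.qm j i
  qv i := (q.qv i)⁻¹
  qm_ne_zero i j := q.qm_ne_zero j i
  qv_ne_zero i := inv_ne_zero (q.qv_ne_zero i)
  qm_symm i j := q.qm_symm j i
  qm_diag i := q.qm_diag i
  qv_opp i := by rw [q.qv_opp]
  qm_opp i j := by
    rw [q.qm_symm j i.opp, q.qm_opp, mul_inv, inv_inv, q.qm_symm i j, inv_pow]

theorem opC_transpose (q : ParamFamily K r) : (opC q).transpose = opC q.transpose := by
  have hP : (opP q).transpose = opP q.transpose := by
    ext u d
    simp only [Matrix.transpose_apply, opP, ParamFamily.transpose]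
    by_cases h : u.1 = d.2 ∧ u.2 = d.1
    · rw [if_pos h, if_pos ⟨h.2.symm, h.1.symm⟩, h.1, h.2]
    · rw [if_neg h, if_neg (fun h' => h ⟨h'.2.symm, h'.1.symm⟩)]
  have hQ : (opQ q).transpose = opQ q.transpose := by
    ext u d
    simp only [Matrix.transpose_apply, opQ, ParamFamily.transpose]
    by_cases h : u.1 = u.2.opp ∧ d.1 = d.2.opp
    · rw [if_pos h, if_pos h.symm, inv_inv]
      ring
    · rw [if_neg h, if_neg (fun h' => h h'.symm)]
  rw [opC, opC, Matrix.transpose_sub, Matrix.transpose_smul, Matrix.transpose_smul,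
    Matrix.transpose_sub, Matrix.transpose_one, hP, hQ]

/-- The relation matrix `1 - C_q` is the transpose of `1 - C_{q'}` for the transposed parameters
`q'`, so `Ξ*_{C_q}` is `Ξ_{C_{q'}}`. -/
theorem xiStar_psi_eq_zero [CharZero K] (hr : 1 ≤ r) (q : ParamFamily K r) {k : ℕ}
    (hk : r + 1 ≤ k) (I : Fin k → Idx r) : XiStar.psi (opC q) I = 0 := by
  have h : ∀ I : Fin k → Idx r, QuadAlg.monomial (1 - opC q.transpose).transpose I = 0 :=
    (QuadAlg.component_eq_bot_iff _).mp (xiComponent_eq_bot q.transpose hr hk)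
  have e : (1 - opC q.transpose).transpose = 1 - opC q := by
    rw [Matrix.transpose_sub, Matrix.transpose_one, ← opC_transpose, Matrix.transpose_transpose]
  rw [e] at h
  exact h I

end Transpose

/-! ### Functionals on the components of a quadratic algebra -/

section Functional

variable {K : Type*} [Field K] {ι : Type*} [Fintype ι] (R : Matrix (ι × ι) (ι × ι) K)

/-- The functionals on the free algebra, given by their values on monomials, that vanish on the
ideal generated by the relations. -/
def relationAnnihilator : Submodule K (List ι → K) where
  carrier := {φ | ∀ c u v, ∑ p : ι × ι, R c p * φ (u ++ p.1 :: p.2 :: v) = 0}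
  zero_mem' c u v := by simp
  add_mem' {φ χ} hφ hχ c u v := by
    simp only [Pi.add_apply, mul_add, Finset.sum_add_distrib, hφ c u v, hχ c u v, add_zero]
  smul_mem' a φ hφ c u v := by
    simp only [Pi.smul_apply, smul_eq_mul, mul_left_comm _ a, ← Finset.mul_sum, hφ c u v, mul_zero]

/-- Precomposition of functionals with right multiplication by a generator. -/
def precompGen (i : ι) : Module.End K (relationAnnihilator R) where
  toFun φ := ⟨fun w => φ.1 (w ++ [i]), fun c u v => by
    simpa using φ.2 c u (v ++ [i])⟩
  map_add' _ _ := rfl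
  map_smul' _ _ := rfl

theorem precompGen_relation (c : ι × ι) :
    ∑ p : ι × ι, R c p • (precompGen R p.1 * precompGen R p.2) = 0 := by
  refine LinearMap.ext fun φ => Subtype.ext (funext fun w => ?_)
  rw [LinearMap.sum_apply, Submodule.coe_sum, Finset.sum_apply]
  simpa [precompGen] using φ.2 c w []

theorem prod_precompGen_apply (l : List ι) (φ : relationAnnihilator R) (w : List ι) :
    ((l.map (precompGen R)).prod φ).1 w = φ.1 (w ++ l) := by
  induction l generalizing w with
  | nil => simp
  | cons i l ih =>
    rw [List.map_cons, List.prod_cons, Module.End.mul_apply]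
    exact (ih (w ++ [i])).trans (by simp)

/-- The quadratic algebra acts on the annihilator through `precompGen`, and `φ` at a word is the
value at the empty word of that monomial applied to `φ`. -/
theorem apply_eq_zero_of_monomial_eq_zero {φ : List ι → K} (hφ : φ ∈ relationAnnihilator R) {k : ℕ}
    {I : Fin k → ι} (hI : QuadAlg.monomial R I = 0) : φ (List.ofFn I) = 0 := by
  have h := prod_precompGen_apply R (List.ofFn I) ⟨φ, hφ⟩ []
  have h1 : ((List.ofFn I).map (precompGen R)).prod =
      QuadAlg.lift R (precompGen R) (precompGen_relation R) (QuadAlg.monomial R I) := by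
    rw [QuadAlg.monomial, map_list_prod, List.map_ofFn, List.map_ofFn]
    congr 2
    funext a
    exact (QuadAlg.lift_gen R _ _ _).symm
  rw [h1, hI, map_zero] at h
  exact h.symm

end Functional

/-! ### Uniqueness of the pairing operator -/

section SiteOp

variable {K : Type*} [Field K] {ι : Type*} [Fintype ι] [DecidableEq ι]

theorem sum_mul_siteOp {k : ℕ} {a b : Fin k} (N : Matrix (ι × ι) (ι × ι) K)
    {e : ι × ι → Fin k → ι} (ha : ∀ p, e p a = p.1) (hb : ∀ p, e p b = p.2)
    (he : ∀ p c x, x ≠ a → x ≠ b → e p x = e c x) (f : (Fin k → ι) → K) (c : ι × ι) :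
    ∑ J, f J * siteOp N a b J (e c) = ∑ p, f (e p) * N p c := by
  have hinj : Function.Injective e := fun p p' h =>
    Prod.ext (by rw [← ha p, h, ha]) (by rw [← hb p, h, hb])
  refine (Fintype.sum_of_injective e hinj _ _ (fun J hJ => ?_) fun p => ?_).symm
  · rw [siteOp, if_neg, mul_zero]
    refine fun h => hJ ⟨(J a, J b), funext fun x => ?_⟩
    by_cases hxa : x = a
    · rw [hxa, ha]
    by_cases hxb : x = b
    · rw [hxb, hb]
    rw [h x hxa hxb, he _ c x hxa hxb]
  · rw [siteOp, if_pos (he p c), ha, hb, ha, hb]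

theorem eq_zero_of_mul_one_sub_adjOp {A : Matrix (ι × ι) (ι × ι) K} {k : ℕ}
    (hA : ∀ I : Fin k → ι, Xi.psi A I = 0) {T : Matrix (Fin k → ι) (Fin k → ι) K}
    (hT : ∀ a, 1 ≤ a → a < k → T * (1 - adjOp A k a) = 0) : T = 0 := by
  ext I J
  -- Row `I` of `T`, extended by zero to words of length other than `k`.
  let φ : List ι → K := fun l => if h : l.length = k then T I fun x => l.get (x.cast h.symm) else 0
  have hφ : φ ∈ relationAnnihilator (1 - A).transpose := by
    intro c u v
    by_cases hk : (u ++ c.1 :: c.2 :: v).length = k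
    · have hk' : ∀ p : ι × ι, (u ++ p.1 :: p.2 :: v).length = k := fun p => by simpa using hk
      have hlen : u.length + 2 + v.length = k := by
        rw [← hk]
        simp
        omega
      let e : ι × ι → Fin k → ι := fun p x =>
        (u ++ p.1 :: p.2 :: v).get (x.cast (hk' p).symm)
      have hsum := sum_mul_siteOp (a := ⟨u.length, by omega⟩) (b := ⟨u.length + 1, by omega⟩)
        A (e := e) (fun p => by simp [e]) (fun p => by simp [e]) (fun p c x hxa hxb => by
          have h1 : x.1 ≠ u.length := fun h => hxa (Fin.ext h)
          have h2 : x.1 ≠ u.length + 1 := fun h => hxb (Fin.ext h)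
          simp only [e, List.get_eq_getElem, Fin.val_cast, List.getElem_append]
          split_ifs with h
          · rfl
          · obtain ⟨m, hm⟩ : ∃ m, x.1 - u.length = m + 2 := ⟨x.1 - u.length - 2, by omega⟩
            simp [hm]) (T I) c
      -- `adjOp` numbers sites from 1, so `a = u.length + 1` acts on the zero-based positions
      -- `u.length` and `u.length + 1`, just after `u`.
      have h0 := congrFun (congrFun (hT (u.length + 1) (by omega) (by omega)) I) (e c)
      rw [mul_sub, mul_one, Matrix.sub_apply, Matrix.mul_apply, adjOp,
        dif_pos ⟨by omega, by omega⟩] at h0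
      have hval : ∀ p : ι × ι, φ (u ++ p.1 :: p.2 :: v) = T I (e p) := fun p => dif_pos (hk' p)
      simp only [hval, Matrix.transpose_apply, Matrix.sub_apply, sub_mul, Finset.sum_sub_distrib]
      simp only [Nat.add_sub_cancel] at h0
      rw [hsum] at h0
      simpa [Matrix.one_apply, mul_comm] using h0
    · refine Finset.sum_eq_zero fun p _ => ?_
      rw [show φ (u ++ p.1 :: p.2 :: v) = 0 from dif_neg (by simpa using hk), mul_zero]
  have h := apply_eq_zero_of_monomial_eq_zero _ hφ (hA J)
  rw [show φ (List.ofFn J) = T I J by simp [φ]] at h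
  exact h

end SiteOp

theorem isPairingAOperator_iff {K : Type*} [Field K] [CharZero K] {r : ℕ} (hr : 1 ≤ r)
    (q : ParamFamily K r) {k : ℕ} (hk : r + 1 ≤ k)
    (T : Matrix (Fin k → Idx r) (Fin k → Idx r) K) : IsPairingAOperator (opC q) k T ↔ T = 0 := by
  have hpsi : ∀ I : Fin k → Idx r, Xi.psi (opC q) I = 0 :=
    (QuadAlg.component_eq_bot_iff _).mp (xiComponent_eq_bot q hr hk)
  constructor
  · exact fun h => eq_zero_of_mul_one_sub_adjOp hpsi h.right_eq
  · rintro rfl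
    exact ⟨fun _ _ _ => mul_zero _, fun _ _ _ => zero_mul _, fun J => by simp [hpsi],
      fun I => by simp [xiStar_psi_eq_zero hr q hk]⟩

/-! ### Intertwiners pass to the Brauer idempotent -/

section Semiconj

variable {K : Type*} [Field K] {B : Type*} [Ring B] [Algebra K B]

theorem semiconjBy_list_prod {γ : Type*} {D : B} {f g : γ → B} (l : List γ)
    (h : ∀ c ∈ l, SemiconjBy D (f c) (g c)) : SemiconjBy D (l.map f).prod (l.map g).prod := by
  induction l with
  | nil => simp
  | cons c l ih =>
    simp only [List.map_cons, List.prod_cons]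
    exact (h c (by simp)).mul_right (ih fun c hc => h c (by simp [hc]))

theorem brauerS_semiconjBy {D : B} {σ ε σ' ε' : ℕ → B} (hσ : ∀ a, SemiconjBy D (σ a) (σ' a))
    (hε : ∀ a, SemiconjBy D (ε a) (ε' a)) (ω : K) (k : ℕ) :
    SemiconjBy D (brauerS ω k σ ε) (brauerS ω k σ' ε') := by
  have hsmul : ∀ (t : K) {x y : B}, SemiconjBy D x y → SemiconjBy D (t • x) (t • y) := by
    intro t x y h
    rw [SemiconjBy, mul_smul_comm, h.eq, smul_mul_assoc]
  have hconj : ∀ {x x' : ℕ → B}, (∀ a, SemiconjBy D (x a) (x' a)) → ∀ a b,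
      SemiconjBy D (brauerConj σ x a b) (brauerConj σ' x' a b) := fun hx a b =>
    ((semiconjBy_list_prod _ fun c _ => hσ c).mul_right (hx _)).mul_right
      (semiconjBy_list_prod _ fun c _ => hσ c)
  have hY : ∀ b, SemiconjBy D (brauerY σ ε b) (brauerY σ' ε' b) := by
    intro b
    rw [SemiconjBy, brauerY, brauerY, Finset.mul_sum, Finset.sum_mul]
    exact Finset.sum_congr rfl fun a _ => ((hconj hσ a b).sub_right (hconj hε a b)).eq
  refine hsmul _ (semiconjBy_list_prod _ fun b _ => hsmul _ ?_)
  exact ((hY b).add_right (SemiconjBy.one_right D)).mul_right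
    ((hY b).add_right (Algebra.commutes _ _).symm)

end Semiconj

/-! ### The diagonal twist -/

section Twist

variable {K : Type*} [Field K] {r : ℕ}

/-- The product of `h (i_a) (i_b)` over the pairs of positions `a < b` of a list. -/
def pairProd {ι : Type*} (h : ι → ι → K) : List ι → K
  | [] => 1
  | x :: l => (l.map (h x)).prod * pairProd h l

theorem pairProd_ne_zero {ι : Type*} {h : ι → ι → K} (hh : ∀ i j, h i j ≠ 0) (l : List ι) :
    pairProd h l ≠ 0 := by
  induction l with
  | nil => exact one_ne_zero
  | cons x l ih =>
    refine mul_ne_zero (List.prod_ne_zero ?_) ih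
    simp [hh]

/-- Under `hl` and `hr` the interaction of the two adjacent letters with all others is unchanged, so
only their mutual factor varies. The ratio is cross-multiplied to avoid division. -/
theorem pairProd_append {ι : Type*} {h : ι → ι → K} {i j i' j' : ι}
    (hl : ∀ x, h x i * h x j = h x i' * h x j') (hr : ∀ x, h i x * h j x = h i' x * h j' x)
    (u v : List ι) :
    pairProd h (u ++ i :: j :: v) * h i' j' = pairProd h (u ++ i' :: j' :: v) * h i j := by
  induction u with
  | nil =>
    have hv : (v.map (h i)).prod * (v.map (h j)).prod =
        (v.map (h i')).prod * (v.map (h j')).prod := by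
      rw [← List.prod_map_mul, ← List.prod_map_mul]
      simp only [hr]
    simp only [List.nil_append, pairProd, List.map_cons, List.prod_cons]
    linear_combination h i j * h i' j' * pairProd h v * hv
  | cons x u ih =>
    simp only [List.cons_append, pairProd, List.map_append, List.map_cons, List.prod_append,
      List.prod_cons]
    linear_combination (u.map (h x)).prod * (v.map (h x)).prod * (h x i * h x j) * ih +
      (u.map (h x)).prod * (v.map (h x)).prod * pairProd h (u ++ i' :: j' :: v) * h i j * hl x

theorem ofFn_eq_take_append_drop {ι : Type*} {k a : ℕ} (h : 1 ≤ a ∧ a < k) (I : Fin k → ι) :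
    List.ofFn I = (List.ofFn I).take (a - 1) ++
      I ⟨a - 1, by omega⟩ :: I ⟨a, h.2⟩ :: (List.ofFn I).drop (a + 1) := by
  conv_lhs => rw [← List.take_append_drop (a - 1) (List.ofFn I)]
  rw [List.drop_eq_getElem_cons (by simp; omega), List.getElem_ofFn]
  congr 2
  rw [Nat.sub_add_cancel h.1, List.drop_eq_getElem_cons (by simp; omega), List.getElem_ofFn]

theorem adjOp_semiconjBy {ι : Type*} [Fintype ι] [DecidableEq ι] {N N' : Matrix (ι × ι) (ι × ι) K}
    {G : List ι → K}
    (hG : ∀ u v p c, G (u ++ p.1 :: p.2 :: v) * N p c = N' p c * G (u ++ c.1 :: c.2 :: v))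
    (k a : ℕ) :
    SemiconjBy (Matrix.diagonal fun I : Fin k → ι => G (List.ofFn I)) (adjOp N k a)
      (adjOp N' k a) := by
  unfold adjOp
  split_ifs with h
  · ext I J
    rw [Matrix.diagonal_mul, Matrix.mul_diagonal, siteOp, siteOp]
    split_ifs with hIJ
    · have h1 := ofFn_eq_take_append_drop h I
      have h2 := ofFn_eq_take_append_drop h J
      have hne : ∀ (x : ℕ) (hx : x < k), x ≠ a - 1 → x ≠ a → I ⟨x, hx⟩ = J ⟨x, hx⟩ :=
        fun x hx h1 h2 => hIJ ⟨x, hx⟩ (fun h => h1 (Fin.mk.inj h)) (fun h => h2 (Fin.mk.inj h))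
      have hu : (List.ofFn J).take (a - 1) = (List.ofFn I).take (a - 1) := by
        refine List.ext_getElem (by simp) fun n hn1 hn2 => ?_
        simp only [List.length_take, List.length_ofFn, lt_inf_iff] at hn1
        simp [hne n (by omega) (by omega) (by omega)]
      have hv : (List.ofFn J).drop (a + 1) = (List.ofFn I).drop (a + 1) := by
        refine List.ext_getElem (by simp) fun n hn1 hn2 => ?_
        simp only [List.length_drop, List.length_ofFn] at hn1
        simp [hne (a + 1 + n) (by omega) (by omega) (by omega)]
      rw [hu, hv] at h2
      rw [h1, h2]
      exact hG _ _ (I ⟨a - 1, by omega⟩, I ⟨a, h.2⟩) (J ⟨a - 1, by omega⟩, J ⟨a, h.2⟩)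
    · simp
  · exact SemiconjBy.zero_right _

/-- The undeformed parameters. -/
def ParamFamily.trivial (K : Type*) [Field K] (r : ℕ) : ParamFamily K r where
  qm _ _ := 1
  qv _ := 1
  qm_ne_zero _ _ := one_ne_zero
  qv_ne_zero _ := one_ne_zero
  qm_symm _ _ := by simp
  qm_diag _ := rfl
  qv_opp _ := by simp
  qm_opp _ _ := by simp

variable (q : ParamFamily K r)

/-- The absolute value of an index. -/
def Idx.abs (i : Idx r) : Fin r := Sum.elim id id i

theorem Idx.abs_opp (i : Idx r) : i.opp.abs = i.abs := by
  rcases i with i | i <;> rfl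

theorem Idx.eq_or_eq_opp_of_abs_eq {i j : Idx r} (h : i.abs = j.abs) : j = i ∨ j = i.opp := by
  rcases i with i | i <;> rcases j with j | j <;> simp_all [Idx.abs]

/-- The value `twist i j` for `|i| < |j|`. -/
def ParamFamily.twistLt (i j : Idx r) : K := Sum.elim (fun _ => 1) (fun _ => q.qv i ^ 2) j

/-- A substitute for a square root of `q_ji`. -/
def ParamFamily.twist (i j : Idx r) : K :=
  if i.abs = j.abs then q.qv i
  else if i.abs < j.abs then q.twistLt i j else q.qm j i * q.twistLt j i

/-- This ratio is exactly the weight `q_ij` by which `P_q` differs from the flip. -/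
theorem ParamFamily.twist_swap (i j : Idx r) : q.twist j i = q.qm i j * q.twist i j := by
  unfold ParamFamily.twist
  rcases lt_trichotomy i.abs j.abs with h | h | h
  · rw [if_neg h.ne', if_neg h.not_gt, if_neg h.ne, if_pos h]
  · rw [if_pos h, if_pos h.symm]
    rcases Idx.eq_or_eq_opp_of_abs_eq h with rfl | rfl
    · rw [q.qm_diag, one_mul]
    · have := q.qv_ne_zero i
      rw [q.qv_opp, q.qm_opp_right]
      field_simp
  · rw [if_neg h.ne, if_pos h, if_neg h.ne', if_neg h.not_gt, ← mul_assoc, q.qm_mul_qm, one_mul]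

/-- Together with `twist_mul_twist_opp_right`, this makes the interaction of a pair `(i, -i)` with
other letters independent of `i`, as `Q_q` requires. The values `1` and `q_i ^ 2` in `twistLt` are
chosen for this, with no square roots. -/
theorem ParamFamily.twist_mul_twist_opp (i j : Idx r) : q.twist i j * q.twist i.opp j = 1 := by
  unfold ParamFamily.twist
  rw [Idx.abs_opp]
  have hi := q.qv_ne_zero i
  have hj := q.qv_ne_zero j
  split_ifs with h h'
  · rw [q.qv_opp, mul_inv_cancel₀ hi]
  · rcases j with j | j
    · simp [ParamFamily.twistLt]
    · simp only [ParamFamily.twistLt, Sum.elim_inr, q.qv_opp]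
      field_simp
  · have h1 := q.qm_mul_qm_opp_right i j
    have h2 : q.twistLt j i * q.twistLt j i.opp = q.qv j ^ 2 := by
      rcases i with i | i <;> simp [ParamFamily.twistLt]
    rw [mul_mul_mul_comm, h1, h2, inv_mul_cancel₀ (pow_ne_zero 2 hj)]

theorem ParamFamily.twist_mul_twist_opp_right (i j : Idx r) :
    q.twist j i * q.twist j i.opp = q.qv j ^ 2 := by
  rw [q.twist_swap i j, q.twist_swap i.opp j, mul_mul_mul_comm, q.twist_mul_twist_opp, mul_one,
    q.qm_mul_qm_opp]

theorem ParamFamily.twist_ne_zero (i j : Idx r) : q.twist i j ≠ 0 :=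
  left_ne_zero_of_mul_eq_one (q.twist_mul_twist_opp i j)

/-- The mutual factor of a pair `(i, -i)`; it produces the weight `q_i q_j⁻¹` in `Q_q`. -/
theorem ParamFamily.twist_opp (i : Idx r) : q.twist i i.opp = q.qv i := by
  rw [ParamFamily.twist, if_pos (Idx.abs_opp i).symm]

theorem pairProd_twist_mul_opP (u v : List (Idx r)) (p c : Idx r × Idx r) :
    pairProd q.twist (u ++ p.1 :: p.2 :: v) * opP (ParamFamily.trivial K r) p c =
      opP q p c * pairProd q.twist (u ++ c.1 :: c.2 :: v) := by
  unfold opP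
  split_ifs with h
  · have h1 := pairProd_append (h := q.twist) (i := c.2) (j := c.1) (i' := c.1) (j' := c.2)
      (fun x => mul_comm _ _) (fun x => mul_comm _ _) u v
    rw [h.1, h.2]
    refine mul_right_cancel₀ (q.twist_ne_zero c.1 c.2) ?_
    rw [ParamFamily.trivial, mul_one, h1, q.twist_swap c.1 c.2]
    ring
  · simp

theorem pairProd_twist_mul_opQ (u v : List (Idx r)) (p c : Idx r × Idx r) :
    pairProd q.twist (u ++ p.1 :: p.2 :: v) * opQ (ParamFamily.trivial K r) p c =
      opQ q p c * pairProd q.twist (u ++ c.1 :: c.2 :: v) := by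
  unfold opQ
  split_ifs with h
  · obtain ⟨h1, h2⟩ := h
    rw [Idx.eq_opp_comm] at h1 h2
    have h3 := pairProd_append (h := q.twist) (i := p.1) (j := p.1.opp) (i' := c.1) (j' := c.1.opp)
      (fun x => by rw [q.twist_mul_twist_opp_right, q.twist_mul_twist_opp_right])
      (fun x => by rw [q.twist_mul_twist_opp, q.twist_mul_twist_opp]) u v
    rw [q.twist_opp, q.twist_opp] at h3
    rw [h1, h2]
    have hc := q.qv_ne_zero c.1
    simp only [ParamFamily.trivial]
    field_simp
    linear_combination p.1.sgn K * c.1.sgn K * h3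
  · simp

theorem trace_opCk (k : ℕ) : (opCk q k).trace = (opCk (ParamFamily.trivial K r) k).trace := by
  set G : (Fin k → Idx r) → K := fun I => pairProd q.twist (List.ofFn I)
  have hG : ∀ I, G I ≠ 0 := fun I => pairProd_ne_zero q.twist_ne_zero _
  have h : SemiconjBy (Matrix.diagonal G) (opCk (ParamFamily.trivial K r) k) (opCk q k) :=
    brauerS_semiconjBy
      (fun a => (adjOp_semiconjBy (G := pairProd q.twist) (pairProd_twist_mul_opP q) k a).neg_right)
      (fun a => (adjOp_semiconjBy (G := pairProd q.twist) (pairProd_twist_mul_opQ q) k a).neg_right)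
      _ k
  refine Finset.sum_congr rfl fun I _ => ?_
  -- Both sides of the intertwining relation have `G I` as a factor on the diagonal, so the two
  -- operators agree there entry by entry.
  have h1 := congrFun (congrFun h.eq I) I
  rw [Matrix.diagonal_mul, Matrix.mul_diagonal, mul_comm] at h1
  exact (mul_right_cancel₀ (hG I) h1).symm

end Twist

end ManinC

theorem mainTheorem3 {K : Type*} [Field K] [CharZero K] (r : ℕ) (hr : 1 ≤ r)
    (q : ManinC.ParamFamily K r) :
    (∀ k : ℕ, 1 ≤ k → k ≤ r + 1 →
      (Module.finrank K (ManinC.Xi.component (ManinC.opC q) k) : ℚ) =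
        (2 * (r : ℚ) - 2 * (k : ℚ) + 2) / (k : ℚ) * (Nat.choose (2 * r + 1) (k - 1) : ℚ)) ∧
    (∀ k : ℕ, r + 1 ≤ k → ManinC.Xi.component (ManinC.opC q) k = ⊥) ∧
    (∀ (q' : ManinC.ParamFamily K r) (k : ℕ), 2 ≤ k → k ≤ r + 1 →
      (ManinC.opCk q k).trace = (ManinC.opCk q' k).trace) ∧
    (∀ (k : ℕ), r + 1 ≤ k →
      (∀ T : Matrix (Fin k → ManinC.Idx r) (Fin k → ManinC.Idx r) K,
        ManinC.IsPairingAOperator (ManinC.opC q) k T ↔ T = 0) ∧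
      ∀ (κ : Type*) [Fintype κ] (B : Matrix (κ × κ) (κ × κ) K) (_ : IsIdempotentElem B)
        (𝔯 : Type*) [Ring 𝔯] [Algebra K 𝔯] (M : Matrix (ManinC.Idx r) κ 𝔯),
        ManinC.IsManinMatrix (ManinC.opC q) B M →
        ∀ T : Matrix (Fin k → ManinC.Idx r) (Fin k → ManinC.Idx r) K,
          ManinC.IsPairingAOperator (ManinC.opC q) k T → ManinC.aMinor T M = 0) := by
  refine ⟨fun k hk hkr => ManinC.finrank_xiComponent q hr hk hkr,
    fun k hk => ManinC.xiComponent_eq_bot q hr hk,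
    fun q' k _ _ => (ManinC.trace_opCk q k).trans (ManinC.trace_opCk q' k).symm,
    fun k hk => ⟨ManinC.isPairingAOperator_iff hr q hk, ?_⟩⟩
  intro κ _ B _ 𝔯 _ _ M _ T hT
  rw [(ManinC.isPairingAOperator_iff hr q hk T).mp hT]
  funext I L
  simp [ManinC.aMinor]
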